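/- Let $d\ge 3$ and $\alpha,\beta>0$. Consider a sequence $(\mathcal G_n)_{n\ge1}$ of finite connected simple $d$-regular graphs, $\mathcal G_n$ having $N_n$ vertices, with $N_n$ increasing and $N_n\to\infty$, such that for all $n$: (i) for every vertex $x$ the ball $B_{\mathcal G_n}(x,\lfloor\alpha\log_{d-1}N_n\rfloor)$ contains at most one cycle, i.e. has tree excess at most $1$; (ii) the spectral gap of $\mathcal G_n$ (the smallest non-zero eigenvalue of $I-P$, where $P$ is the transition matrix of simple random walk) is at least $\beta$. Here the tree excess $\mathtt{tx}(U)$ of a connected vertex set $U$ is the maximal number of edges that can be deleted from the subgraph induced by $U$ while keeping it connected; thus $\mathtt{tx}(U)=0$ if and only if $U$ induces a tree. Let $\Psi=\Psi_{\mathcal G_n}$ under $\mathbb P^{\mathcal G_n}$ be the zero-average Gaussian free field on $\mathcal G_n$: the centred Gaussian field $(\Psi(x))_{x\in\mathcal G_n}$ with covariance $$G_{\mathcal G_n}(x,y)=\int_0^\infty\Big(P_x^{\mathcal G_n}[\overline X_t=y]-\frac1{N_n}\Big)\,dt,$$ where $\overline X$ is the continuous-time simple random walk on $\mathcal G_n$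 with i.i.d. mean-one exponential holding times. For $A\subseteq\mathcal G_n$ non-empty and $r\ge1$ let $B(A,r)$ be the set of vertices at distance at most $r$ from $A$, let $\partial A$ be the set of vertices outside $A$ with a neighbour in $A$, and for $x\in\partial A$ let $F_A(x,r)$ be the set of vertices that are connected to $x$ in $B(A,r)\setminus A$. Put $s_n=\max\{1,\lfloor 8\log_{d-1}(\log_{d-1}N_n)\rfloor\}$. A vertex $x\in\partial A$ is called a *good vertex at the boundary of $A$* if - $x$ has exactly one neighbour $\overline x$ in $A$; - $\mathtt{tx}(F_A(x,s_n))=0$; - for every $y\in\partial A\setminus\{x\}$, every path in $\mathcal G_n\setminus A$ from $y$ to $x$ leaves $B(A,s_n)$. **Proposition.** For all $b,b'>0$ there is a constant $c_{b,b'}>0$, depending only on $d,\alpha,\beta,b,b'$, such that for all $n\ge1$, all non-empty $A\subseteq\mathcal G_n$ with $|A|\le b\ln N_n$ and every good vertex $x$ at the boundary of $A$, almost surely on the event $\{\sup_{z\in A}|\Psi(z)|\le b'\sqrt{\ln N_n}\}$, $$\Big|\mathbb E^{\mathcal G_n}\big[\Psi(x)\,\big|\,\sigma(\Psi(y),\,y\in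 A)\big]-\tfrac1{d-1}\Psi(\overline x)\Big|\le c_{b,b'}(\ln N_n)^{-2}$$ and $$\Big|\operatorname{Var}_{\mathbb P^{\mathcal G_n}}\big(\Psi(x)\,\big|\,\sigma(\Psi(y),\,y\in A)\big)-\tfrac d{d-1}\Big|\le c_{b,b'}(\ln N_n)^{-3}.$$ -/

import Mathlib

open MeasureTheory ProbabilityTheory

noncomputable section

namespace ZeroAvgGFF

section GraphNotions

variable {V : Type*} (G : SimpleGraph V)

/-- The closed ball `B(x, R)` for the graph distance. -/
def closedBall (x : V) (R : ℕ) : Set V := {y | G.edist x y ≤ (R : ℕ∞)}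

/-- The `R`-neighbourhood `B(A, R)` of a set of vertices. -/
def nbhd (A : Set V) (R : ℕ) : Set V := {z | ∃ w ∈ A, z ∈ closedBall G w R}

/-- The outer vertex boundary of `A`. -/
def outerBoundary (A : Set V) : Set V := {y | y ∉ A ∧ ∃ x ∈ A, G.Adj x y}

/-- Tree excess of a (finite, connected) set `U` of vertices: the maximal number of edges that can
be deleted from the subgraph induced by `U` while keeping it connected. -/
def treeExcess (U : Set V) : ℕ :=
  sSup {k : ℕ | ∃ s : Finset (Sym2 U), (s : Set (Sym2 U)) ⊆ (G.induce U).edgeSet ∧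
    ((G.induce U).deleteEdges (s : Set (Sym2 U))).Connected ∧ s.card = k}

/-- `F_A(x, r)`: the vertices that can be joined to `x` inside `B(A, r) \ A`. -/
def localComponent (A : Set V) (x : V) (r : ℕ) : Set V :=
  {z | ∃ w : G.Walk z x, ∀ v ∈ w.support, v ∈ nbhd G A r \ A}

/-- `x` is a good vertex at the boundary of `A`, at scale `s`. -/
structure IsGoodBoundaryVertex (s : ℕ) (A : Set V) (x : V) : Prop where
  mem_boundary : x ∈ outerBoundary G A
  /-- `x` has exactly one neighbour in `A` (note that `x ∉ A`). -/
  unique_neighbour : (closedBall G x 1 ∩ A).ncard = 1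
  treeLike : treeExcess G (localComponent G A x s) = 0
  /-- Every path outside `A` from another boundary vertex to `x` leaves `B(A, s)`. -/
  separated : ∀ y ∈ outerBoundary G A \ {x}, ∀ w : G.Walk y x,
    (∀ v ∈ w.support, v ∉ A) → ∃ v ∈ w.support, v ∉ nbhd G A s

end GraphNotions

/-- The scale `s_n = max {1, ⌊8 log_{d-1} (log_{d-1} N)⌋}`. -/
def scale (d N : ℕ) : ℕ :=
  max 1 ⌊8 * Real.logb ((d : ℝ) - 1) (Real.logb ((d : ℝ) - 1) (N : ℝ))⌋₊

section RandomWalk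

variable {V : Type*} [Fintype V] [DecidableEq V] (G : SimpleGraph V) [DecidableRel G.Adj]

/-- Transition matrix of simple random walk on `G`; `(transitionMatrix G ^ k) x y` is the
probability that the discrete-time walk started at `x` is at `y` at time `k`. -/
def transitionMatrix : Matrix V V ℝ :=
  Matrix.of fun x y => if G.Adj x y then ((G.degree x : ℝ))⁻¹ else 0

/-- The spectral gap: the smallest non-zero eigenvalue of `I - P`. -/
def spectralGap : ℝ :=
  sInf {μ : ℝ | μ ≠ 0 ∧
    Module.End.HasEigenvalue (Matrix.toLin' (1 - transitionMatrix G)) μ}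

/-- Transition probabilities of the continuous-time simple random walk with i.i.d. mean-one
exponential holding times: by time `t` the walk has made a Poisson(`t`) number of jumps,
independent of its discrete skeleton. -/
def heatKernel (t : ℝ) (x y : V) : ℝ :=
  ∑' k : ℕ, Real.exp (-t) * t ^ k / (k.factorial : ℝ) * (transitionMatrix G ^ k) x y

/-- The zero-average Green function of simple random walk on `G`. -/
def greenFunction : Matrix V V ℝ :=
  Matrix.of fun x y => ∫ t in Set.Ioi (0 : ℝ), (heatKernel G t x y - 1 / (Fintype.card V : ℝ))

/-- The law on `V → ℝ` of the zero-average Gaussian free field: the centred Gaussian measure whose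
covariance matrix is the zero-average Green function. The field itself is the coordinate process. -/
def fieldLaw : Measure (V → ℝ) :=
  (multivariateGaussian (0 : EuclideanSpace ℝ V) (greenFunction G)).map
    (fun v : EuclideanSpace ℝ V => fun x => v x)

end RandomWalk

/-- The standing assumptions on a sequence of graphs, `N_n` being the number of vertices of the
`n`-th graph: `N_n` is increasing and tends to infinity, and every graph is `d`-regular, connected,
has at most one cycle (tree excess at most one) in each ball of radius `⌊α log_{d-1} N_n⌋`, and has
spectral gap at least `β`. -/
structure StandingAssumptions (d : ℕ) (α β : ℝ) {V : ℕ → Type*} [∀ n, Fintype (V n)]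
    [∀ n, DecidableEq (V n)] (G : ∀ n, SimpleGraph (V n)) [∀ n, DecidableRel (G n).Adj] :
    Prop where
  card_mono : Monotone fun n => Fintype.card (V n)
  card_tendsto : Filter.Tendsto (fun n => Fintype.card (V n)) Filter.atTop Filter.atTop
  regular : ∀ n, (G n).IsRegularOfDegree d
  connected : ∀ n, (G n).Connected
  locally_unicyclic : ∀ n, ∀ x : V n,
    treeExcess (G n)
      (closedBall (G n) x ⌊α * Real.logb ((d : ℝ) - 1) (Fintype.card (V n) : ℝ)⌋₊) ≤ 1
  spectral_gap : ∀ n, β ≤ spectralGap (G n)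

end ZeroAvgGFF

end

/-! Write `t = 1/(d-1)`, `L = ln N`, and `g` for the zero-average Green function. For a centred
Gaussian vector the conditional mean given `A` is `∑ a z * Ψ z`, with `a` solving the normal
equations on `A`, and the conditional variance is the corresponding Schur complement. If a good
vertex `x` were the root of an infinite tree hanging from `xbar`, killed on `A`, then `a` would be
`t` times the indicator of `xbar` and the variance would be `d/(d-1)`. It therefore suffices that
the residual `g y x - t * g y xbar` be at most some small `ε` on `A` and within `ε` of `d/(d-1)` at
`y = x`. Since the eigenvalues of `I - P` are at most 2, `g` is coercive on functions supported on
`A` (`coercive_on`). Hence the correction to `a` has `ℓ²` norm `O(√|A| ε)`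
(`exists_normal_equations`, `ae_condExp_condVar_le`).

The residual is estimated with the function `h` that decays by `t` per step away from `x` inside the
tree `F_A(x, s)` (`exists_geometric_function`). Its Laplacian is the source at `x`, minus `t` at
`xbar`, plus terms on the edges leaving `B(A, s)`. As `g` inverts the Laplacian up to averages, the
residual reduces to values of `g` at distance about `s`, with total flux one, and a volume term over
`N` (`IsGoodBoundaryVertex.abs_green_sub_le`).

Decay of `g` (`abs_green_le_of_not_mem_closedBall`) comes from a truncated tree Green function built
from non-backtracking walks. Its Laplacian is a point source plus two shells at the truncation
radius. At most one cycle means at most `k + 1` non-backtracking walks of length `k` between two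
vertices, so the shells have small `ℓ²` norm, and the spectral gap bounds `g` on `ℓ²`. This gives
only the square root of the tree decay, which is enough: `(d-1)^s` is of order `L^8`, so `ε` is of
order `(L * L^(-8))^(1/2) = L^(-7/2)`. The mean error is then `|A| * ε * sup |Ψ| ≲ L^(1 - 7/2 + 1/2)
= L^(-2)`, and the variance error is `ε + |A| * ε^2 ≲ L^(-3)`. Graphs of bounded size are absorbed
into the constant. -/

namespace ZeroAvgGFF

/-! ### Spectral analysis of the zero-average Green function -/

section Spectral

variable {V : Type*} [Fintype V] [DecidableEq V]

/-- An orthonormal system of eigenvectors `u i` of the real matrix `M`, with eigenvalues `μ i`. -/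
structure IsEigensystem (M : Matrix V V ℝ) (u : V → V → ℝ) (μ : V → ℝ) : Prop where
  mulVec_eq : ∀ i x, ∑ y, M x y * u i y = μ i * u i x
  sum_mul_vertex : ∀ i j, ∑ x, u i x * u j x = if i = j then 1 else 0
  sum_mul_index : ∀ x y, ∑ i, u i x * u i y = if x = y then 1 else 0

theorem exists_isEigensystem {M : Matrix V V ℝ} (hM : M.IsHermitian) :
    ∃ u μ, IsEigensystem M u μ := by
  refine ⟨fun i x => hM.eigenvectorBasis i x, hM.eigenvalues, ?_, ?_, ?_⟩
  · intro i x
    have := congrFun (hM.mulVec_eigenvectorBasis i) x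
    simpa [Matrix.mulVec, dotProduct] using this
  · intro i j
    have := hM.eigenvectorBasis.inner_eq_ite j i
    simp only [PiLp.inner_apply, RCLike.inner_apply, conj_trivial] at this
    rw [this]
    simp [eq_comm]
  · intro x y
    have := congrFun (congrFun (Unitary.coe_mul_star_self hM.eigenvectorUnitary) x) y
    simpa [Matrix.mul_apply, Matrix.one_apply] using this

namespace IsEigensystem

variable {M : Matrix V V ℝ} {u : V → V → ℝ} {μ : V → ℝ}

theorem pow_apply (h : IsEigensystem M u μ) (k : ℕ) (x y : V) :
    (M ^ k) x y = ∑ i, μ i ^ k * (u i x * u i y) := by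
  induction k generalizing x with
  | zero => simp [h.sum_mul_index, Matrix.one_apply]
  | succ k ih =>
    rw [pow_succ', Matrix.mul_apply]
    simp_rw [ih, Finset.mul_sum]
    rw [Finset.sum_comm]
    refine Finset.sum_congr rfl fun i _ => ?_
    have := h.mulVec_eq i x
    calc ∑ z, M x z * (μ i ^ k * (u i z * u i y))
        = (∑ z, M x z * u i z) * (μ i ^ k * u i y) := by
          rw [Finset.sum_mul]; exact Finset.sum_congr rfl fun z _ => by ring
      _ = _ := by rw [this]; ring

theorem sum_sq_vertex (h : IsEigensystem M u μ) (i : V) : ∑ x, u i x ^ 2 = 1 := by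
  simpa [sq] using h.sum_mul_vertex i i

theorem sum_sq_index (h : IsEigensystem M u μ) (x : V) : ∑ i, u i x ^ 2 = 1 := by
  simpa [sq] using h.sum_mul_index x x

theorem sum_sq_coeff (h : IsEigensystem M u μ) (v : V → ℝ) :
    ∑ i, (∑ x, u i x * v x) ^ 2 = ∑ x, v x ^ 2 := by
  calc ∑ i, (∑ x, u i x * v x) ^ 2
      = ∑ i, ∑ x, ∑ y, (v x * v y) * (u i x * u i y) := by
        refine Finset.sum_congr rfl fun i _ => ?_
        rw [sq, Finset.sum_mul_sum]
        exact Finset.sum_congr rfl fun x _ => Finset.sum_congr rfl fun y _ => by ring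
    _ = ∑ x, ∑ y, (v x * v y) * ∑ i, u i x * u i y := by
        rw [Finset.sum_comm]
        refine Finset.sum_congr rfl fun x _ => ?_
        rw [Finset.sum_comm]
        exact Finset.sum_congr rfl fun y _ => by rw [Finset.mul_sum]
    _ = _ := by simp [h.sum_mul_index, sq]

end IsEigensystem

variable (G : SimpleGraph V) [DecidableRel G.Adj]

omit [DecidableEq V] in
theorem sum_transitionMatrix_mul {d : ℕ} (hreg : G.IsRegularOfDegree d) (φ : V → ℝ) (x : V) :
    ∑ y, transitionMatrix G x y * φ y = (∑ y ∈ G.neighborFinset x, φ y) / d := by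
  simp [transitionMatrix, hreg x, ite_mul, ← Finset.sum_filter, SimpleGraph.neighborFinset_eq_filter,
    ← Finset.mul_sum, div_eq_inv_mul]

omit [DecidableEq V] in
theorem isHermitian_transitionMatrix {d : ℕ} (hreg : G.IsRegularOfDegree d) :
    (transitionMatrix G).IsHermitian := by
  ext x y
  simp [transitionMatrix, hreg x, hreg y, G.adj_comm]

omit [DecidableEq V] in
theorem sum_neighborFinset_comm (a b : V → ℝ) :
    ∑ x, a x * ∑ y ∈ G.neighborFinset x, b y = ∑ x, (∑ y ∈ G.neighborFinset x, a y) * b x := by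
  simp_rw [SimpleGraph.neighborFinset_eq_filter, Finset.sum_filter, Finset.mul_sum, Finset.sum_mul]
  rw [Finset.sum_comm]
  refine Finset.sum_congr rfl fun x _ => Finset.sum_congr rfl fun y _ => ?_
  simp [G.adj_comm]

/-- Spectral decomposition of the zero-average Green function. -/
structure IsGreenEigensystem (d : ℕ) (β : ℝ) (u : V → V → ℝ) (μ : V → ℝ) : Prop where
  sum_neighbor : ∀ i x, ∑ y ∈ G.neighborFinset x, u i y = d * (1 - μ i) * u i x
  -- Only the orthonormality relations of `u` are retained from here; `M` and `ν` play no further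
  -- role.
  system : ∃ M : Matrix V V ℝ, ∃ ν, IsEigensystem M u ν
  gap : ∀ i, μ i = 0 ∨ β ≤ μ i
  le_two : ∀ i, μ i ≤ 2
  sum_zero : ∀ x y, ∑ i, (if μ i = 0 then 1 else 0) * (u i x * u i y) = 1 / (Fintype.card V : ℝ)
  -- For `μ i = 0` the convention `0⁻¹ = 0` removes the constant mode, in agreement with the
  -- subtraction of `1/N` in the definition.
  green : ∀ x y, greenFunction G x y = ∑ i, (μ i)⁻¹ * (u i x * u i y)

variable {G}

theorem exists_isGreenEigensystem {d : ℕ} (hd : 0 < d) (hreg : G.IsRegularOfDegree d)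
    (hconn : G.Connected) {β : ℝ} (hβ : 0 < β) (hgap : β ≤ spectralGap G) :
    ∃ u μ, IsGreenEigensystem G d β u μ := by
  have hd' : (0 : ℝ) < d := by exact_mod_cast hd
  have := hconn.nonempty
  have hN : (0 : ℝ) < Fintype.card V := by exact_mod_cast Fintype.card_pos
  obtain ⟨u, ν, h⟩ := exists_isEigensystem (isHermitian_transitionMatrix G hreg)
  have hnb : ∀ i x, ∑ y ∈ G.neighborFinset x, u i y = d * ν i * u i x := by
    intro i x
    have := h.mulVec_eq i x
    rw [sum_transitionMatrix_mul G hreg, div_eq_iff hd'.ne'] at this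
    linarith
  have hne : ∀ i, ∃ x, u i x ≠ 0 := by
    intro i
    by_contra! hc
    simpa [hc] using h.sum_sq_vertex i
  -- Expansion of a sum of squares `(u x + c * u y)^2` over adjacent pairs; the case `c = 1` gives
  -- `ν i ≥ -1`, hence the upper bound 2 on the spectrum of `I - P`.
  have hquad : ∀ i (c : ℝ), c ^ 2 = 1 → 0 ≤ d + c * (d * ν i) := by
    intro i c hc
    have h1 : ∑ x, u i x * ∑ y ∈ G.neighborFinset x, u i y = d * ν i := by
      trans (d * ν i) * ∑ x, u i x ^ 2
      · rw [Finset.mul_sum]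
        exact Finset.sum_congr rfl fun x _ => by rw [hnb]; ring
      · rw [h.sum_sq_vertex, mul_one]
    have h2 : ∑ x, ∑ y ∈ G.neighborFinset x, u i x ^ 2 = d := by
      simp [hreg _, ← Finset.mul_sum, h.sum_sq_vertex]
    have h3 : ∑ x, ∑ y ∈ G.neighborFinset x, u i y ^ 2 = d := by
      have := sum_neighborFinset_comm G (fun _ => 1) (fun y => u i y ^ 2)
      simp only [one_mul] at this
      rw [this]
      simp [hreg _, ← Finset.mul_sum, h.sum_sq_vertex]
    have h4 : 0 ≤ ∑ x, ∑ y ∈ G.neighborFinset x, (u i x + c * u i y) ^ 2 := by positivity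
    have h5 : ∑ x, ∑ y ∈ G.neighborFinset x, (u i x + c * u i y) ^ 2
        = d + c ^ 2 * d + 2 * c * (d * ν i) := by
      rw [← h1]
      nth_rewrite 1 [← h2]
      rw [← h3]
      simp_rw [Finset.mul_sum, ← Finset.sum_add_distrib]
      exact Finset.sum_congr rfl fun x _ => Finset.sum_congr rfl fun y _ => by ring
    rw [h5, hc] at h4
    linarith
  have hle : ∀ i, 1 - ν i ≤ 2 := by
    intro i
    have := hquad i 1 (by norm_num)
    nlinarith
  have hgap' : ∀ i, 1 - ν i = 0 ∨ β ≤ 1 - ν i := by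
    intro i
    by_cases h0 : 1 - ν i = 0
    · exact .inl h0
    right
    refine hgap.trans (csInf_le ?_ ⟨h0, ?_⟩)
    · exact ((Module.End.finite_hasEigenvalue
        (Matrix.toLin' (1 - transitionMatrix G))).subset fun μ hμ => hμ.2).bddBelow
    · refine Module.End.hasEigenvalue_of_hasEigenvector (x := u i) ⟨?_, ?_⟩
      · rw [Module.End.mem_eigenspace_iff]
        ext x
        simp only [Matrix.toLin'_apply, Matrix.sub_mulVec, Matrix.one_mulVec, Pi.sub_apply,
          Pi.smul_apply, smul_eq_mul]
        have := h.mulVec_eq i x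
        rw [Matrix.mulVec, dotProduct, this]
        ring
      · obtain ⟨x, hx⟩ := hne i
        exact fun hc => hx (by rw [hc]; rfl)
  have hconst : ∀ i, 1 - ν i = 0 → ∀ x y, u i x = u i y := by
    intro i hi x y
    refine (SimpleGraph.lapMatrix_mulVec_eq_zero_iff_forall_reachable G (x := u i)).1 ?_ x y
      (hconn.preconnected x y)
    ext z
    rw [SimpleGraph.lapMatrix_mulVec_apply, hnb, hreg z]
    have : ν i = 1 := by linarith
    simp [this]
  have horth : ∀ i, 1 - ν i ≠ 0 → ∑ x, u i x = 0 := by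
    intro i hi
    have h1 := sum_neighborFinset_comm G (fun _ => 1) (u i)
    simp only [one_mul, hnb, Finset.sum_const, SimpleGraph.card_neighborFinset_eq_degree,
      hreg _, nsmul_eq_mul, mul_one, ← Finset.mul_sum] at h1
    have h2 : (d : ℝ) * (1 - ν i) * ∑ x, u i x = 0 := by linarith
    simpa [hd'.ne', hi] using h2
  -- Null modes are constant and all others sum to zero, so in both cases `N` times the term is `u i
  -- x * ∑ z, u i z`; completeness then sums these to one, with no need for the multiplicity of the
  -- null eigenvalue.
  have hsum0 : ∀ x y, ∑ i, (if 1 - ν i = 0 then 1 else 0) * (u i x * u i y)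
      = 1 / (Fintype.card V : ℝ) := by
    intro x y
    rw [eq_div_iff hN.ne']
    have : ∀ i, (if 1 - ν i = 0 then (1 : ℝ) else 0) * (u i x * u i y) * Fintype.card V
        = u i x * ∑ z, u i z := by
      intro i
      split_ifs with hi
      · have : ∑ z, u i z = ∑ z : V, u i y := Finset.sum_congr rfl fun z _ => hconst i hi z y
        rw [this]
        simp
        ring
      · simp [horth i hi]
    rw [Finset.sum_mul]
    simp_rw [this, Finset.mul_sum]
    rw [Finset.sum_comm]
    simp [h.sum_mul_index]
  refine ⟨u, fun i => 1 - ν i, fun i x => ?_, ⟨_, _, h⟩, hgap', hle, hsum0, ?_⟩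
  · rw [hnb]; ring
  intro x y
  have hheat : ∀ t : ℝ, heatKernel G t x y - 1 / (Fintype.card V : ℝ)
      = ∑ i, (if 1 - ν i = 0 then 0 else Real.exp (-(1 - ν i) * t)) * (u i x * u i y) := by
    intro t
    have h1 : HasSum (fun k : ℕ => ∑ i, Real.exp (-t) * ((t * ν i) ^ k / (k.factorial : ℝ))
        * (u i x * u i y)) (∑ i, Real.exp (-t) * Real.exp (t * ν i) * (u i x * u i y)) := by
      refine hasSum_sum fun i _ => ?_
      have := NormedSpace.expSeries_div_hasSum_exp (t * ν i)
      rw [← Real.exp_eq_exp_ℝ] at this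
      exact (this.mul_left _).mul_right _
    have h2 : heatKernel G t x y = ∑ i, Real.exp (-t) * Real.exp (t * ν i) * (u i x * u i y) := by
      rw [← h1.tsum_eq, heatKernel]
      refine tsum_congr fun k => ?_
      rw [h.pow_apply, Finset.mul_sum]
      refine Finset.sum_congr rfl fun i _ => ?_
      rw [mul_pow]
      ring
    rw [h2, ← hsum0 x y, ← Finset.sum_sub_distrib]
    refine Finset.sum_congr rfl fun i _ => ?_
    rw [← Real.exp_add]
    split_ifs with hi
    · have : -t + t * ν i = 0 := by linear_combination (-t) * hi
      simp [this]
    · rw [show -t + t * ν i = -(1 - ν i) * t by ring]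
      ring
  rw [greenFunction, Matrix.of_apply]
  simp_rw [hheat]
  have hpos : ∀ i, 1 - ν i ≠ 0 → 0 < 1 - ν i := fun i hi =>
    ((hgap' i).resolve_left hi).trans_lt' hβ
  rw [integral_finsetSum]
  · refine Finset.sum_congr rfl fun i _ => ?_
    rw [integral_mul_const]
    split_ifs with hi
    · simp [hi]
    · rw [integral_exp_mul_Ioi (by linarith [hpos i hi])]
      rw [mul_zero, Real.exp_zero, neg_div_neg_eq, one_div]
  · intro i _
    refine Integrable.mul_const ?_ _
    split_ifs with hi
    · simp
    · exact integrableOn_exp_mul_Ioi (by linarith [hpos i hi]) 0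

namespace IsGreenEigensystem

variable {d : ℕ} {β : ℝ} {u : V → V → ℝ} {μ : V → ℝ}

theorem green_comm (h : IsGreenEigensystem G d β u μ) (x y : V) :
    greenFunction G x y = greenFunction G y x := by
  rw [h.green, h.green]
  exact Finset.sum_congr rfl fun i _ => by ring

omit [DecidableEq V] in
theorem _root_.ZeroAvgGFF.sum_mul_sum_mul_sq (c : V → ℝ) (u : V → V → ℝ) (φ : V → ℝ) :
    ∑ z, φ z * ∑ i, c i * u i z * ∑ w, u i w * φ w = ∑ i, c i * (∑ w, u i w * φ w) ^ 2 := by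
  calc _ = ∑ z, ∑ i, φ z * (c i * u i z * ∑ w, u i w * φ w) :=
        Finset.sum_congr rfl fun z _ => Finset.mul_sum _ _ _
    _ = _ := by
        rw [Finset.sum_comm]
        refine Finset.sum_congr rfl fun i _ => ?_
        rw [sq, ← mul_assoc, Finset.mul_sum]
        exact Finset.sum_congr rfl fun z _ => by ring

theorem sum_green_mul (h : IsGreenEigensystem G d β u μ) (φ : V → ℝ) (z : V) :
    ∑ w, greenFunction G z w * φ w = ∑ i, (μ i)⁻¹ * u i z * ∑ w, u i w * φ w := by
  simp_rw [h.green, Finset.sum_mul, Finset.mul_sum]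
  rw [Finset.sum_comm]
  exact Finset.sum_congr rfl fun i _ => Finset.sum_congr rfl fun w _ => by ring

theorem sum_sum_green_mul (h : IsGreenEigensystem G d β u μ) (φ : V → ℝ) :
    ∑ z, φ z * ∑ w, greenFunction G z w * φ w = ∑ i, (μ i)⁻¹ * (∑ w, u i w * φ w) ^ 2 := by
  simp_rw [h.sum_green_mul]
  exact sum_mul_sum_mul_sq _ _ _

theorem inv_nonneg (h : IsGreenEigensystem G d β u μ) (hβ : 0 < β) (i : V) : 0 ≤ (μ i)⁻¹ := by
  rcases h.gap i with h0 | h0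
  · simp [h0]
  · exact _root_.inv_nonneg.2 (hβ.le.trans h0)

theorem posSemidef (h : IsGreenEigensystem G d β u μ) (hβ : 0 < β) :
    (greenFunction G).PosSemidef := by
  refine .of_dotProduct_mulVec_nonneg ?_ fun v => ?_
  · ext x y
    simpa using h.green_comm y x
  · have := h.sum_sum_green_mul v
    simp only [Matrix.mulVec, dotProduct, star_trivial]
    rw [this]
    exact Finset.sum_nonneg fun i _ => mul_nonneg (h.inv_nonneg hβ i) (sq_nonneg _)

theorem sum_zero_mul (h : IsGreenEigensystem G d β u μ) (φ : V → ℝ) (z : V) :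
    ∑ i, (if μ i = 0 then 1 else 0) * u i z * ∑ w, u i w * φ w
      = (∑ w, φ w) / Fintype.card V := by
  calc _ = ∑ w, (∑ i, (if μ i = 0 then 1 else 0) * (u i z * u i w)) * φ w := by
        simp_rw [Finset.sum_mul, Finset.mul_sum]
        rw [Finset.sum_comm]
        exact Finset.sum_congr rfl fun i _ => Finset.sum_congr rfl fun w _ => by ring
    _ = _ := by
        simp_rw [h.sum_zero, ← Finset.mul_sum]
        ring

/-- The Green function inverts the Laplacian on functions with zero average. -/
theorem sum_green_mul_laplacian (h : IsGreenEigensystem G d β u μ) (hd : 0 < d) (φ : V → ℝ)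
    (z : V) :
    ∑ w, greenFunction G z w * (d * φ w - ∑ v ∈ G.neighborFinset w, φ v)
      = d * (φ z - (∑ w, φ w) / Fintype.card V) := by
  have hd' : (0 : ℝ) < d := by exact_mod_cast hd
  obtain ⟨M, ν, hs⟩ := h.system
  have h1 : ∀ i, ∑ w, u i w * (d * φ w - ∑ v ∈ G.neighborFinset w, φ v)
      = d * μ i * ∑ w, u i w * φ w := by
    intro i
    simp_rw [mul_sub, Finset.sum_sub_distrib]
    rw [sum_neighborFinset_comm, ← Finset.sum_sub_distrib, Finset.mul_sum]
    exact Finset.sum_congr rfl fun w _ => by rw [h.sum_neighbor]; ring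
  rw [h.sum_green_mul, ← h.sum_zero_mul φ z]
  have h2 : φ z = ∑ i, u i z * ∑ w, u i w * φ w := by
    simp_rw [Finset.mul_sum]
    rw [Finset.sum_comm]
    simp_rw [← mul_assoc, ← Finset.sum_mul, hs.sum_mul_index]
    simp
  rw [h2]
  rw [← Finset.sum_sub_distrib, Finset.mul_sum]
  refine Finset.sum_congr rfl fun i _ => ?_
  rw [h1]
  split_ifs with hi
  · simp [hi]
  · field_simp
    ring

/-- The multiplier `(μ i)⁻¹` is at most `β⁻¹` and the vector `i ↦ u i z` has norm one, so
Cauchy–Schwarz turns an `ℓ²` bound on a source into a pointwise bound on its potential. This is how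
the spectral gap enters the decay estimate. -/
theorem sq_sum_green_mul_le (h : IsGreenEigensystem G d β u μ) (hβ : 0 < β) (φ : V → ℝ) (z : V) :
    (∑ w, greenFunction G z w * φ w) ^ 2 ≤ (β⁻¹) ^ 2 * ∑ w, φ w ^ 2 := by
  obtain ⟨M, ν, hs⟩ := h.system
  rw [h.sum_green_mul]
  refine (Finset.sum_mul_sq_le_sq_mul_sq _ _ _).trans ?_
  rw [hs.sum_sq_coeff]
  refine mul_le_mul_of_nonneg_right ?_ (by positivity)
  rw [← mul_one ((β⁻¹) ^ 2), ← hs.sum_sq_index z, Finset.mul_sum]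
  refine Finset.sum_le_sum fun i _ => ?_
  rw [mul_pow]
  refine mul_le_mul_of_nonneg_right ?_ (sq_nonneg _)
  refine pow_le_pow_left₀ (h.inv_nonneg hβ i) ?_ 2
  rcases h.gap i with h0 | h0
  · simp [h0, hβ.le]
  · exact inv_anti₀ hβ h0

theorem abs_green_le (h : IsGreenEigensystem G d β u μ) (hβ : 0 < β) (x y : V) :
    |greenFunction G x y| ≤ β⁻¹ := by
  have := h.sq_sum_green_mul_le hβ (fun w => if w = y then 1 else 0) x
  simp only [mul_ite, mul_one, mul_zero, Finset.sum_ite_eq', Finset.mem_univ, if_true, ite_pow,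
    one_pow, ne_eq, OfNat.ofNat_ne_zero, not_false_eq_true, zero_pow] at this
  exact abs_le_of_sq_le_sq this (by positivity)

/-- Away from the constant mode `(μ i)⁻¹ ≥ 1/2`; the subtracted square is exactly the weight of the
constant mode. -/
theorem le_sum_sum_green_mul (h : IsGreenEigensystem G d β u μ) (hβ : 0 < β) (φ : V → ℝ) :
    (∑ w, φ w ^ 2 - (∑ w, φ w) ^ 2 / Fintype.card V) / 2
      ≤ ∑ z, φ z * ∑ w, greenFunction G z w * φ w := by
  obtain ⟨M, ν, hs⟩ := h.system
  have h1 : (∑ w, φ w) ^ 2 / Fintype.card V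
      = ∑ i, (if μ i = 0 then 1 else 0) * (∑ w, u i w * φ w) ^ 2 := by
    rw [← sum_mul_sum_mul_sq]
    simp_rw [h.sum_zero_mul φ]
    rw [← Finset.sum_mul]
    ring
  rw [h.sum_sum_green_mul, ← hs.sum_sq_coeff, h1, ← Finset.sum_sub_distrib, Finset.sum_div]
  refine Finset.sum_le_sum fun i _ => ?_
  rcases h.gap i with h0 | h0
  · simp [h0]
  · have hpos := hβ.trans_le h0
    have : (2 : ℝ)⁻¹ ≤ (μ i)⁻¹ := inv_anti₀ hpos (h.le_two i)
    rw [if_neg hpos.ne', zero_mul, sub_zero, div_eq_inv_mul]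
    exact mul_le_mul_of_nonneg_right this (sq_nonneg _)

end IsGreenEigensystem

end Spectral

end ZeroAvgGFF

namespace ZeroAvgGFF

/-! ### Rooted trees -/

section Trees

variable {U : Type*} {T : SimpleGraph U}

/-- Two neighbours of `a` closer to the root would both be the penultimate vertex of the unique path
from the root to `a`; so the parent is well defined, and every edge joins a vertex to its parent. -/
theorem exists_parent (hT : T.IsTree) (r : U) :
    ∃ f : U → U, f r = r ∧ (∀ a, a ≠ r → T.Adj a (f a) ∧ T.dist r a = T.dist r (f a) + 1) ∧
      ∀ a b, T.Adj a b → (b = f a ∧ T.dist r a = T.dist r b + 1) ∨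
        (a = f b ∧ T.dist r b = T.dist r a + 1) := by
  classical
  have hex : ∀ a, a ≠ r → ∃ b, T.Adj a b ∧ T.dist r a = T.dist r b + 1 := by
    intro a ha
    obtain ⟨p, hp⟩ := hT.connected.exists_walk_length_eq_dist a r
    cases p with
    | nil => exact absurd rfl ha
    | @cons _ b _ hab q =>
      refine ⟨b, hab, ?_⟩
      have h1 := T.dist_le q
      rw [T.dist_comm, ← hp, SimpleGraph.Walk.length_cons]
      rcases hT.dist_eq_dist_add_one_of_adj r hab with h | h
      · rw [T.dist_comm, ← hp, SimpleGraph.Walk.length_cons] at h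
        exact h
      · rw [T.dist_comm (u := r) (v := a), ← hp, SimpleGraph.Walk.length_cons, T.dist_comm] at h
        omega
  have huniq : ∀ a b b', T.Adj a b → T.Adj a b' → T.dist r a = T.dist r b + 1 →
      T.dist r a = T.dist r b' + 1 → b = b' := by
    intro a b b' hb hb' h h'
    obtain ⟨p, hp, -⟩ := hT.connected.exists_path_of_dist r a
    have key : ∀ c, T.Adj a c → T.dist r a = T.dist r c + 1 → c = p.penultimate := by
      intro c hc h
      obtain ⟨q, hq, hql⟩ := hT.connected.exists_path_of_dist r c
      refine hT.isAcyclic.eq_penultimate_of_adj_end hp hc ?_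
      by_contra hcp
      have ha := hT.isAcyclic.mem_support_of_ne_mem_support_of_adj_of_isPath hq hp hc.symm hcp
      have h1 := T.dist_le (q.takeUntil a ha)
      have h2 := q.length_takeUntil_le_length ha
      omega
    rw [key b hb h, key b' hb' h']
  choose! g hg using hex
  refine ⟨fun a => if a = r then r else g a, by simp, ?_, ?_⟩
  · intro a ha
    simpa [ha] using hg a ha
  · have key : ∀ a b, T.Adj a b → T.dist r a = T.dist r b + 1 →
        b = if a = r then r else g a := by
      intro a b hab h
      have ha : a ≠ r := by
        rintro rfl
        simp at h
      rw [if_neg ha]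
      exact huniq a b _ hab (hg a ha).1 h (hg a ha).2
    intro a b hab
    rcases hT.dist_eq_dist_add_one_of_adj r hab with h | h
    · exact .inl ⟨key a b hab h, h⟩
    · exact .inr ⟨key b a hab.symm h, h⟩

end Trees

/-! ### Tree excess and spanning trees -/

section Excess

variable {V : Type*} [Finite V] {G : SimpleGraph V}

/-- The edges outside a spanning tree can all be deleted at once, so they are competitors in the
supremum defining the tree excess. -/
theorem exists_isTree_card_le_treeExcess {U : Set V} (hU : (G.induce U).Connected) :
    ∃ T : SimpleGraph U, T.IsTree ∧ ∃ s : Finset (Sym2 U), s.card ≤ treeExcess G U ∧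
      ∀ a b, (G.induce U).Adj a b → T.Adj a b ∨ s(a, b) ∈ s := by
  classical
  have := Fintype.ofFinite V
  obtain ⟨T, hle, hT⟩ := hU.exists_isTree_le
  refine ⟨T, hT, Finset.univ.filter fun e => e ∈ (G.induce U).edgeSet ∧ e ∉ T.edgeSet, ?_, ?_⟩
  · refine le_csSup ⟨Fintype.card (Sym2 U), ?_⟩ ⟨_, ?_, ?_, rfl⟩
    · rintro k ⟨s, -, -, rfl⟩
      exact Finset.card_le_univ s
    · intro e he
      simpa using (Finset.mem_filter.1 he).2.1
    · refine hT.connected.mono fun a b hab => ?_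
      rw [SimpleGraph.deleteEdges_adj]
      refine ⟨hle hab, ?_⟩
      simp [hab]
  · intro a b hab
    by_cases h : T.Adj a b
    · exact .inl h
    · right
      simpa [h] using hab

/-- A vertex set of tree excess at most one carries a map such that every edge inside the set
joins a vertex to its image. -/
theorem exists_functional_of_treeExcess_le_one {U : Set V} (hU : (G.induce U).Connected)
    (h1 : treeExcess G U ≤ 1) :
    ∃ f : V → V, ∀ a ∈ U, ∀ b ∈ U, G.Adj a b → b = f a ∨ a = f b := by
  classical
  obtain ⟨T, hT, s, hs, hadj⟩ := exists_isTree_card_le_treeExcess hU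
  obtain ⟨e, he⟩ : ∃ e : U × U, ∀ e' ∈ s, e' = s(e.1, e.2) := by
    rcases s.eq_empty_or_nonempty with rfl | ⟨e₀, he₀⟩
    · obtain ⟨r⟩ := hU.nonempty
      exact ⟨(r, r), by simp⟩
    · induction e₀ with
      | h a b => exact ⟨(a, b), fun e' he' => Finset.card_le_one.1 (hs.trans h1) _ he' _ he₀⟩
  -- With the tree rooted at an endpoint of the one extra edge, the root needs no parent, and its
  -- image is free to record the other endpoint. Without an extra edge, `e` is a harmless diagonal
  -- pair.
  obtain ⟨f, -, -, hf⟩ := exists_parent hT e.1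
  obtain ⟨g, hg⟩ : ∃ g : U → U, ∀ a b, (G.induce U).Adj a b → b = g a ∨ a = g b := by
    have hroot : ∀ b, T.Adj e.1 b → e.1 = f b := by
      intro b hb
      rcases hf _ _ hb with ⟨-, h⟩ | ⟨h, -⟩
      · simp at h
      · exact h
    refine ⟨fun a => if a = e.1 then e.2 else f a, fun a b hab => ?_⟩
    rcases hadj a b hab with h | h
    · by_cases ha : a = e.1
      · have hb : b ≠ e.1 := by
          rintro rfl
          exact h.ne ha
        subst ha
        right
        simp only [if_neg hb]
        exact hroot b h
      · by_cases hb : b = e.1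
        · subst hb
          left
          simp only [if_neg ha]
          exact hroot a h.symm
        · simp only [if_neg ha, if_neg hb]
          rcases hf a b h with h | h
          · exact .inl h.1
          · exact .inr h.1
    · have := he _ h
      rw [Sym2.eq_iff] at this
      rcases this with ⟨h1, h2⟩ | ⟨h1, h2⟩
      · exact .inl (by simp [h1, h2])
      · exact .inr (by simp [h1, h2])
  refine ⟨fun a => if h : a ∈ U then (g ⟨a, h⟩ : V) else a, fun a ha b hb hab => ?_⟩
  simp only [ha, hb, dif_pos]
  rcases hg ⟨a, ha⟩ ⟨b, hb⟩ hab with h | h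
  · exact .inl (congrArg Subtype.val h)
  · exact .inr (congrArg Subtype.val h)

theorem isTree_induce_of_treeExcess_eq_zero {U : Set V} (hU : (G.induce U).Connected)
    (h0 : treeExcess G U = 0) : (G.induce U).IsTree := by
  obtain ⟨T, hT, s, hs, hadj⟩ := exists_isTree_card_le_treeExcess hU
  have hs' : s = ∅ := by simpa [h0] using hs
  subst hs'
  obtain ⟨T', hle, hT'⟩ := hU.exists_isTree_le
  refine ⟨hU, hT.isAcyclic.anti fun a b hab => ?_⟩
  simpa using hadj a b hab

end Excess

/-! ### Balls in the graph distance -/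

section Balls

variable {V : Type*} {G : SimpleGraph V}

theorem mem_closedBall_of_walk {x y : V} {R : ℕ} (w : G.Walk x y) (h : w.length ≤ R) :
    y ∈ closedBall G x R :=
  (G.edist_le w).trans (by exact_mod_cast h)

theorem mem_closedBall_iff {x y : V} {R : ℕ} :
    y ∈ closedBall G x R ↔ ∃ w : G.Walk x y, w.length ≤ R := by
  refine ⟨fun h => ?_, fun ⟨w, h⟩ => mem_closedBall_of_walk w h⟩
  have h' : G.edist x y ≤ R := h
  obtain ⟨w, hw⟩ := G.exists_walk_of_edist_ne_top (ne_top_of_le_ne_top (ENat.natCast_ne_top R) h')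
  refine ⟨w, ?_⟩
  rw [← hw] at h'
  exact_mod_cast h'

theorem mem_closedBall_self (x : V) (R : ℕ) : x ∈ closedBall G x R := by
  simp [closedBall]

theorem mem_closedBall_comm {x y : V} {R : ℕ} :
    y ∈ closedBall G x R ↔ x ∈ closedBall G y R := by
  simp [closedBall, G.edist_comm]

theorem mem_closedBall_trans {x y z : V} {R S : ℕ} (h : y ∈ closedBall G x R)
    (h' : z ∈ closedBall G y S) : z ∈ closedBall G x (R + S) := by
  have := (G.edist_triangle (u := x) (v := y) (w := z)).trans (add_le_add h h')
  exact_mod_cast this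

theorem mem_closedBall_one {x y : V} (h : G.Adj x y) : y ∈ closedBall G x 1 := by
  simp [closedBall, SimpleGraph.edist_le_one_iff_adj_or_eq, h]

theorem closedBall_mono {x : V} {R S : ℕ} (h : R ≤ S) : closedBall G x R ⊆ closedBall G x S :=
  fun _ hy => le_trans (α := ℕ∞) hy (by exact_mod_cast h)

theorem connected_induce_closedBall (x : V) (R : ℕ) :
    (G.induce (closedBall G x R)).Connected := by
  classical
  rw [SimpleGraph.connected_iff_exists_forall_reachable]
  refine ⟨⟨x, mem_closedBall_self x R⟩, fun ⟨y, hy⟩ => ?_⟩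
  obtain ⟨w, hw⟩ := mem_closedBall_iff.1 hy
  exact ⟨w.induce _ fun v hv => mem_closedBall_of_walk (w.takeUntil v hv)
    ((w.length_takeUntil_le_length hv).trans hw)⟩

theorem exists_finset_closedBall_subset [Fintype V] [DecidableEq V] [DecidableRel G.Adj] {d : ℕ}
    (hreg : G.IsRegularOfDegree d) (x : V) (R : ℕ) :
    ∃ s : Finset V, closedBall G x R ⊆ s ∧ s.card ≤ (d + 1) ^ R := by
  induction R with
  | zero =>
    refine ⟨{x}, fun y hy => ?_, by simp⟩
    have : y ∈ closedBall G x 0 := hy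
    simp only [closedBall, Set.mem_ofPred_eq, Nat.cast_zero, nonpos_iff_eq_zero,
      SimpleGraph.edist_eq_zero_iff] at this
    simp [this]
  | succ R ih =>
    obtain ⟨s, hs, hc⟩ := ih
    refine ⟨s.biUnion fun z => insert z (G.neighborFinset z), fun y hy => ?_, ?_⟩
    · obtain ⟨w, hw⟩ := mem_closedBall_iff.1 (mem_closedBall_comm.1 hy)
      simp only [Finset.coe_biUnion, Set.mem_iUnion]
      cases w with
      | nil => exact ⟨x, hs (mem_closedBall_self x R), by simp⟩
      | @cons _ z _ hyz q =>
        refine ⟨z, hs (mem_closedBall_comm.1 (mem_closedBall_of_walk q ?_)), ?_⟩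
        · simpa using hw
        · simp [hyz.symm]
    · refine (Finset.card_biUnion_le_card_mul _ _ (d + 1) fun z _ => ?_).trans ?_
      · refine (Finset.card_insert_le _ _).trans ?_
        simp [hreg z]
      · rw [pow_succ]
        exact Nat.mul_le_mul_right _ hc

end Balls

end ZeroAvgGFF

namespace ZeroAvgGFF

/-! ### Non-backtracking walks and decay of the Green function -/

section NonBacktracking

variable {V : Type*} [Fintype V] [DecidableEq V] (G : SimpleGraph V) [DecidableRel G.Adj]

/-- The number of non-backtracking walks of length `k + 1` started at `y` whose last step goes
from `a` to `b`. -/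
def nbDart (y : V) : ℕ → V → V → ℝ
  | 0, a, b => if G.Adj a b ∧ a = y then 1 else 0
  | k + 1, a, b => if G.Adj a b then ∑ c ∈ Finset.univ.erase b, nbDart y k c a else 0

/-- The number of non-backtracking walks of length `k` from `y` to `b`. -/
def nbCount (y : V) : ℕ → V → ℝ
  | 0, b => if b = y then 1 else 0
  | k + 1, b => ∑ a, nbDart G y k a b

variable {G}

theorem nbDart_nonneg (y : V) (k : ℕ) (a b : V) : 0 ≤ nbDart G y k a b := by
  induction k generalizing a b with
  | zero => unfold nbDart; split_ifs <;> norm_num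
  | succ k ih =>
    unfold nbDart
    split_ifs
    · exact Finset.sum_nonneg fun c _ => ih c a
    · exact le_rfl

theorem nbCount_nonneg (y : V) (k : ℕ) (b : V) : 0 ≤ nbCount G y k b := by
  cases k with
  | zero => simp only [nbCount]; split_ifs <;> norm_num
  | succ k => exact Finset.sum_nonneg fun a _ => nbDart_nonneg y k a b

theorem nbDart_eq_zero {y : V} {k : ℕ} {a b : V} (h : ¬ G.Adj a b) : nbDart G y k a b = 0 := by
  cases k <;> simp [nbDart, h]

theorem mem_closedBall_of_nbDart_ne_zero {y : V} {k : ℕ} {a b : V} (h : nbDart G y k a b ≠ 0) :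
    a ∈ closedBall G y k ∧ b ∈ closedBall G y (k + 1) := by
  have hab : G.Adj a b := by
    by_contra hc
    exact h (nbDart_eq_zero hc)
  suffices ha : a ∈ closedBall G y k from ⟨ha, mem_closedBall_trans ha (mem_closedBall_one hab)⟩
  induction k generalizing a b with
  | zero =>
    simp only [nbDart, ne_eq, ite_eq_right_iff, one_ne_zero, imp_false, not_not] at h
    rw [h.2]
    exact mem_closedBall_self y 0
  | succ k ih =>
    simp only [nbDart, if_pos hab] at h
    obtain ⟨c, -, hc⟩ := Finset.exists_ne_zero_of_sum_ne_zero h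
    have hca : G.Adj c a := by
      by_contra hn
      exact hc (nbDart_eq_zero hn)
    exact mem_closedBall_trans (ih hc hca) (mem_closedBall_one hca)

theorem nbCount_eq_zero {y z : V} {k : ℕ} (h : z ∉ closedBall G y k) : nbCount G y k z = 0 := by
  cases k with
  | zero =>
    rw [nbCount, if_neg]
    rintro rfl
    exact h (mem_closedBall_self z 0)
  | succ k =>
    refine Finset.sum_eq_zero fun a _ => ?_
    by_contra hc
    exact h (mem_closedBall_of_nbDart_ne_zero hc).2

theorem sum_neighbor_nbCount_zero (y b : V) :
    ∑ a ∈ G.neighborFinset b, nbCount G y 0 a = nbCount G y 1 b := by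
  simp only [nbCount, nbDart, SimpleGraph.neighborFinset_eq_filter, Finset.sum_filter]
  refine Finset.sum_congr rfl fun a _ => ?_
  rw [ite_and]
  exact if_congr (G.adj_comm b a) rfl rfl

theorem sum_nbDart_right_zero {d : ℕ} (hreg : G.IsRegularOfDegree d) (y b : V) :
    ∑ a, nbDart G y 0 b a = d * nbCount G y 0 b := by
  have h : ∀ a, nbDart G y 0 b a = (if G.Adj b a then 1 else 0) * (if b = y then 1 else 0) := by
    intro a
    simp only [nbDart, ite_and]
    split_ifs <;> simp
  simp_rw [h, ← Finset.sum_mul, nbCount]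
  simp [← SimpleGraph.neighborFinset_eq_filter, hreg b]

/-- A nonempty non-backtracking walk ending at `b` has exactly `d - 1` extensions. -/
theorem sum_nbDart_right_succ {d : ℕ} (hreg : G.IsRegularOfDegree d) (y : V) (k : ℕ) (b : V) :
    ∑ a, nbDart G y (k + 1) b a = (d - 1) * nbCount G y (k + 1) b := by
  have h1 : ∀ c, ∑ a ∈ G.neighborFinset b, (if c ≠ a then nbDart G y k c b else 0)
      = (d - 1) * nbDart G y k c b := by
    intro c
    by_cases hc : G.Adj c b
    · have h2 : c ∈ G.neighborFinset b := by simpa using hc.symm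
      rw [← Finset.sum_erase_add _ _ h2, if_neg (by simp), add_zero,
        Finset.sum_congr rfl (g := fun _ => nbDart G y k c b)
          (fun a ha => if_pos (Finset.ne_of_mem_erase ha).symm)]
      have h3 : 1 ≤ d := by
        rw [← hreg b, ← SimpleGraph.card_neighborFinset_eq_degree]
        exact Finset.card_pos.2 ⟨c, h2⟩
      simp [Finset.card_erase_of_mem h2, hreg b, Nat.cast_sub h3]
    · simp [nbDart_eq_zero hc]
  rw [nbCount, Finset.mul_sum]
  simp_rw [← h1]
  rw [Finset.sum_comm, SimpleGraph.neighborFinset_eq_filter, Finset.sum_filter]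
  refine Finset.sum_congr rfl fun a _ => ?_
  rw [nbDart]
  refine if_congr Iff.rfl ?_ rfl
  rw [← Finset.sum_filter]
  refine Finset.sum_congr ?_ fun _ _ => rfl
  ext c
  simp

/-- A walk ending at a neighbour `a` of `b` either can be extended to `b` without backtracking or
has just arrived from `b`. -/
theorem sum_neighbor_nbCount_succ (y : V) (k : ℕ) (b : V) :
    ∑ a ∈ G.neighborFinset b, nbCount G y (k + 1) a
      = nbCount G y (k + 2) b + ∑ a, nbDart G y k b a := by
  simp only [nbCount]
  rw [← Finset.sum_add_distrib, SimpleGraph.neighborFinset_eq_filter, Finset.sum_filter]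
  refine Finset.sum_congr rfl fun a _ => ?_
  by_cases h : G.Adj b a
  · rw [if_pos h, nbDart, if_pos h.symm, Finset.sum_erase_add _ _ (Finset.mem_univ b)]
  · rw [if_neg h, nbDart_eq_zero h, nbDart_eq_zero fun h' => h h'.symm, add_zero]

theorem sum_nbCount {d : ℕ} (hreg : G.IsRegularOfDegree d) (y : V) (k : ℕ) :
    ∑ b, nbCount G y (k + 1) b = d * (d - 1) ^ k := by
  have h1 : ∀ k, ∑ b, nbCount G y (k + 1) b = ∑ b, ∑ a, nbDart G y k b a := by
    intro k
    rw [Finset.sum_comm]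
    rfl
  induction k with
  | zero =>
    rw [h1]
    simp_rw [sum_nbDart_right_zero hreg, nbCount]
    simp
  | succ k ih =>
    rw [h1]
    simp_rw [sum_nbDart_right_succ hreg]
    rw [← Finset.mul_sum, ih]
    ring

/-- The truncated Green function of the `d`-regular tree, projected to the graph. -/
noncomputable def nbGreen (G : SimpleGraph V) [DecidableRel G.Adj] (d : ℕ) (y : V) (J : ℕ) (z : V) : ℝ :=
  ∑ k ∈ Finset.range (J + 1), ((d - 1 : ℝ)⁻¹) ^ k * nbCount G y k z

/-- With weights `(d-1)^(-k)` the recursion for walk counts telescopes, leaving the source at `y`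
and the two outermost shells. Regularity is enough here; no local tree structure is needed. -/
theorem laplacian_nbGreen {d : ℕ} (hd : 2 ≤ d) (hreg : G.IsRegularOfDegree d) (y : V) (J : ℕ)
    (b : V) :
    d * nbGreen G d y (J + 1) b - ∑ a ∈ G.neighborFinset b, nbGreen G d y (J + 1) a
      = d * (1 - (d - 1 : ℝ)⁻¹) * nbCount G y 0 b
        - ((d - 1 : ℝ)⁻¹) ^ (J + 1) * (nbCount G y (J + 2) b - nbCount G y (J + 1) b) := by
  have hd' : (2 : ℝ) ≤ d := by exact_mod_cast hd
  have hne : (d - 1 : ℝ) ≠ 0 := by linarith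
  induction J with
  | zero =>
    simp only [nbGreen, Finset.sum_range_succ, Finset.sum_range_zero, zero_add, pow_zero, one_mul,
      pow_one, Finset.sum_add_distrib, ← Finset.mul_sum, sum_neighbor_nbCount_zero,
      sum_neighbor_nbCount_succ, sum_nbDart_right_zero hreg]
    field_simp
    ring
  | succ J ih =>
    have hs : ∀ a, nbGreen G d y (J + 1 + 1) a = nbGreen G d y (J + 1) a
        + ((d - 1 : ℝ)⁻¹) ^ (J + 2) * nbCount G y (J + 2) a := fun a =>
      Finset.sum_range_succ _ _
    simp_rw [hs, Finset.sum_add_distrib, ← Finset.mul_sum]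
    rw [sum_neighbor_nbCount_succ, sum_nbDart_right_succ hreg]
    have h2 : ((d - 1 : ℝ)⁻¹) ^ (J + 1) = (d - 1) * ((d - 1 : ℝ)⁻¹) ^ (J + 2) := by
      rw [pow_succ _ (J + 1)]
      field_simp
    rw [h2] at ih
    rw [mul_add, add_sub_add_comm, ih, show J + 1 + 1 = J + 2 from rfl,
      show J + 1 + 2 = J + 3 from rfl]
    ring

/-- In the presence of a functional structure on the edges, every non-backtracking walk first
follows the function and then goes against it. -/
theorem nbDart_le {y : V} {R : ℕ} {f : V → V}
    (hf : ∀ a ∈ closedBall G y R, ∀ b ∈ closedBall G y R, G.Adj a b → b = f a ∨ a = f b)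
    {k : ℕ} (hk : k + 1 ≤ R) (a b : V) :
    nbDart G y k a b ≤ k + 1 ∧
      (a ≠ f b → nbDart G y k a b ≤ 1 ∧ (nbDart G y k a b ≠ 0 → a = f^[k] y)) := by
  induction k generalizing a b with
  | zero =>
    have h1 : nbDart G y 0 a b ≤ 1 := by
      unfold nbDart
      split_ifs <;> norm_num
    refine ⟨by simpa using h1, fun _ => ⟨h1, fun h => ?_⟩⟩
    simp only [nbDart, ne_eq, ite_eq_right_iff, one_ne_zero, imp_false, not_not] at h
    simpa using h.2
  | succ k ih =>
    have ih' := ih (by omega)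
    by_cases hz : nbDart G y (k + 1) a b = 0
    · rw [hz]
      exact ⟨by positivity, fun _ => ⟨zero_le_one, fun h => absurd rfl h⟩⟩
    have hab : G.Adj a b := by
      by_contra hc
      exact hz (nbDart_eq_zero hc)
    -- A previous step `c → a` that does not go against `f` belongs to the initial stretch following
    -- `f`, so its starting point is forced.
    have hup : ∀ c, c ≠ f a → c ≠ f^[k] y → nbDart G y k c a = 0 := by
      intro c hc hc'
      by_contra h0
      exact hc' (((ih' c a).2 hc).2 h0)
    have hup_le : ∀ s : Finset V, f a ∉ s → ∑ c ∈ s, nbDart G y k c a ≤ 1 := by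
      intro s hs
      by_cases hmem : f^[k] y ∈ s
      · rw [Finset.sum_eq_single_of_mem _ hmem
          fun c hc hne => hup c (fun h => hs (h ▸ hc)) hne]
        exact ((ih' _ a).2 fun h => hs (h ▸ hmem)).1
      · rw [Finset.sum_eq_zero fun c hc =>
          hup c (fun h => hs (h ▸ hc)) fun h => hmem (h ▸ hc)]
        exact zero_le_one
    have hball := mem_closedBall_of_nbDart_ne_zero hz
    have hba := hf a (closedBall_mono (by omega) hball.1) b (closedBall_mono (by omega) hball.2) hab
    have hval : nbDart G y (k + 1) a b = ∑ c ∈ Finset.univ.erase b, nbDart G y k c a := by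
      rw [nbDart, if_pos hab]
    -- When the last step follows `f`, one has `b = f a`, and not backtracking excludes precisely
    -- the predecessor `f a`: a step against `f` is never followed by a step along `f`.
    have hdown : a ≠ f b → f a ∉ Finset.univ.erase b := by
      intro h
      simp [hba.resolve_right h]
    refine ⟨?_, fun h => ⟨hval ▸ hup_le _ (hdown h), fun _ => ?_⟩⟩
    · rw [hval]
      refine (Finset.sum_le_sum_of_subset_of_nonneg (Finset.erase_subset _ _)
        fun c _ _ => nbDart_nonneg y k c a).trans ?_
      rw [← Finset.sum_erase_add _ _ (Finset.mem_univ (f a))]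
      have := hup_le (Finset.univ.erase (f a)) (by simp)
      have := (ih' (f a) a).1
      push_cast
      linarith
    · rw [hval] at hz
      obtain ⟨c, hc, hc0⟩ := Finset.exists_ne_zero_of_sum_ne_zero hz
      have hcf : c ≠ f a := fun h' => hdown h (h' ▸ hc)
      have hca : G.Adj c a := by
        by_contra hn
        exact hc0 (nbDart_eq_zero hn)
      have hb := mem_closedBall_of_nbDart_ne_zero hc0
      have := hf c (closedBall_mono (by omega) hb.1) a (closedBall_mono (by omega) hb.2) hca
      rw [this.resolve_right hcf, ((ih' c a).2 hcf).2 hc0, Function.iterate_succ_apply']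

theorem nbCount_le {y : V} {R : ℕ} {f : V → V}
    (hf : ∀ a ∈ closedBall G y R, ∀ b ∈ closedBall G y R, G.Adj a b → b = f a ∨ a = f b)
    {k : ℕ} (hk : k ≤ R) (b : V) : nbCount G y k b ≤ k + 1 := by
  cases k with
  | zero =>
    simp only [nbCount]
    split_ifs <;> norm_num
  | succ k =>
    have h := nbDart_le hf hk
    rw [nbCount, ← Finset.sum_erase_add _ _ (Finset.mem_univ (f b))]
    have h1 : ∑ a ∈ Finset.univ.erase (f b), nbDart G y k a b ≤ 1 := by
      have h0 : ∀ a ∈ Finset.univ.erase (f b), a ≠ f^[k] y → nbDart G y k a b = 0 := by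
        intro a ha hne
        by_contra hc
        exact hne (((h a b).2 (Finset.ne_of_mem_erase ha)).2 hc)
      by_cases hmem : f^[k] y ∈ Finset.univ.erase (f b)
      · rw [Finset.sum_eq_single_of_mem _ hmem h0]
        exact ((h _ b).2 (Finset.ne_of_mem_erase hmem)).1
      · rw [Finset.sum_eq_zero fun a ha => h0 a ha fun hc => hmem (hc ▸ ha)]
        exact zero_le_one
    have h2 := (h (f b) b).1
    push_cast
    linarith

/-- Decay of the zero-average Green function in a locally unicyclic graph. -/
theorem abs_green_le_of_not_mem_closedBall {d : ℕ} (hd : 3 ≤ d) (hreg : G.IsRegularOfDegree d)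
    {β : ℝ} (hβ : 0 < β) {u : V → V → ℝ} {μ : V → ℝ} (hG : IsGreenEigensystem G d β u μ)
    {y z : V} {J R : ℕ} (hR : J + 2 ≤ R) (hex : treeExcess G (closedBall G y R) ≤ 1)
    (hz : z ∉ closedBall G y (J + 1)) :
    |greenFunction G z y| ≤ 4 * (J + 2) / Fintype.card V
      + 4 * β⁻¹ * √((J + 3) * ((d - 1 : ℝ)⁻¹) ^ (J + 1)) := by
  have hd' : (3 : ℝ) ≤ d := by exact_mod_cast hd
  have hd1 : (0 : ℝ) < d - 1 := by linarith
  have hd0 : (0 : ℝ) < d := by linarith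
  obtain ⟨f, hf⟩ :=
    exists_functional_of_treeExcess_le_one (connected_induce_closedBall y R) hex
  set t : ℝ := (d - 1 : ℝ)⁻¹ with ht
  have ht0 : 0 < t := inv_pos.2 hd1
  have htd : t * (d - 1) = 1 := inv_mul_cancel₀ hd1.ne'
  have ht2 : t ≤ 1 / 2 := by nlinarith
  set X := √((J + 3) * t ^ (J + 1)) with hX
  have hX2 : X ^ 2 = (J + 3) * t ^ (J + 1) := Real.sq_sqrt (by positivity)
  -- The Laplacian of `nbGreen` is integrated against `greenFunction G z`; `nbGreen` vanishes at
  -- `z`, which lies beyond its range, so only its average survives on the right.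
  have hmain : d * (1 - t) * greenFunction G z y
      - (t ^ (J + 1) * ∑ w, greenFunction G z w * nbCount G y (J + 2) w
        - t ^ (J + 1) * ∑ w, greenFunction G z w * nbCount G y (J + 1) w)
      = - (d * ((∑ w, nbGreen G d y (J + 1) w) / Fintype.card V)) := by
    have h := hG.sum_green_mul_laplacian (by omega) (nbGreen G d y (J + 1)) z
    have hz0 : nbGreen G d y (J + 1) z = 0 := Finset.sum_eq_zero fun k hk => by
      rw [nbCount_eq_zero fun h' => hz (closedBall_mono (by simp at hk; omega) h'), mul_zero]
    rw [hz0, zero_sub, mul_neg] at h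
    rw [← h]
    have h0 : greenFunction G z y = ∑ w, greenFunction G z w * nbCount G y 0 w := by
      simp [nbCount]
    rw [h0, Finset.mul_sum, Finset.mul_sum, Finset.mul_sum, ← Finset.sum_sub_distrib,
      ← Finset.sum_sub_distrib]
    refine Finset.sum_congr rfl fun w _ => ?_
    rw [laplacian_nbGreen (by omega) hreg]
    ring
  -- The squared `ℓ²` norm of a shell is at most its maximum, `J + 3` by unicyclicity, times its
  -- total mass `d * (d-1)^k`. After multiplication by `t^(J+1)` half of the tree exponent remains.
  have hS : ∀ k, k = J ∨ k = J + 1 →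
      |t ^ (J + 1) * ∑ w, greenFunction G z w * nbCount G y (k + 1) w| ≤ d * β⁻¹ * X := by
    intro k hk
    refine abs_le_of_sq_le_sq ?_ (by positivity)
    have hkJ : (k : ℝ) ≤ J + 1 := by
      rcases hk with rfl | rfl <;> push_cast <;> linarith
    have h1 := hG.sq_sum_green_mul_le hβ (nbCount G y (k + 1)) z
    have h2 : ∑ w, nbCount G y (k + 1) w ^ 2 ≤ (J + 3) * (d * (d - 1) ^ (J + 1)) := by
      calc ∑ w, nbCount G y (k + 1) w ^ 2 ≤ ∑ w, (J + 3) * nbCount G y (k + 1) w := by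
            refine Finset.sum_le_sum fun w _ => ?_
            rw [sq]
            refine mul_le_mul_of_nonneg_right ?_ (nbCount_nonneg _ _ _)
            refine (nbCount_le hf (by omega) w).trans ?_
            push_cast
            linarith
        _ = (J + 3) * (d * (d - 1) ^ k) := by rw [← Finset.mul_sum, sum_nbCount hreg]
        _ ≤ _ := by
            gcongr
            · linarith
            · omega
    have htp : t ^ (J + 1) * (d - 1) ^ (J + 1) = 1 := by rw [← mul_pow, htd, one_pow]
    calc (t ^ (J + 1) * ∑ w, greenFunction G z w * nbCount G y (k + 1) w) ^ 2
        ≤ (t ^ (J + 1)) ^ 2 * (β⁻¹ ^ 2 * ((J + 3) * (d * (d - 1) ^ (J + 1)))) := by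
          rw [mul_pow]
          gcongr
          exact h1.trans (by gcongr)
      _ = d * (β⁻¹ ^ 2 * X ^ 2) * (t ^ (J + 1) * (d - 1) ^ (J + 1)) := by rw [hX2]; ring
      _ ≤ d ^ 2 * (β⁻¹ ^ 2 * X ^ 2) := by
          rw [htp, mul_one]
          gcongr
          nlinarith
      _ = _ := by ring
  -- Each shell of positive radius carries the same mass `d * t ≤ 3/2`.
  have hsum : ∑ w, nbGreen G d y (J + 1) w ≤ 2 * (J + 2) := by
    simp only [nbGreen]
    rw [Finset.sum_comm, Finset.sum_range_succ']
    simp_rw [← Finset.mul_sum, sum_nbCount hreg]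
    have : ∀ k ∈ Finset.range (J + 1), t ^ (k + 1) * (d * (d - 1) ^ k) = d * t := by
      intro k _
      calc t ^ (k + 1) * (d * (d - 1) ^ k) = d * t * (t * (d - 1)) ^ k := by rw [mul_pow]; ring
        _ = d * t := by rw [htd, one_pow, mul_one]
    rw [Finset.sum_congr rfl this]
    have hdt : d * t ≤ 3 / 2 := by linarith
    have : ((J : ℝ) + 1) * (d * t) ≤ (J + 1) * (3 / 2) := by gcongr
    simp [nbCount]
    linarith
  have hsum0 : 0 ≤ ∑ w, nbGreen G d y (J + 1) w :=
    Finset.sum_nonneg fun w _ => Finset.sum_nonneg fun k _ =>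
      mul_nonneg (by positivity) (nbCount_nonneg _ _ _)
  have hN : (∑ w, nbGreen G d y (J + 1) w) / Fintype.card V ≤ 2 * (J + 2) / Fintype.card V := by
    gcongr
  have hN0 : 0 ≤ (∑ w, nbGreen G d y (J + 1) w) / Fintype.card V := by positivity
  have h1 := hS J (.inl rfl)
  have h2 := hS (J + 1) (.inr rfl)
  have h3 : |d * (1 - t) * greenFunction G z y|
      ≤ 2 * (d * β⁻¹ * X) + d * (2 * (J + 2) / Fintype.card V) := by
    have hN' := mul_le_mul_of_nonneg_left hN hd0.le
    have hN0' := mul_nonneg hd0.le hN0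
    rw [abs_le] at h1 h2 ⊢
    constructor <;> linarith [h1.1, h1.2, h2.1, h2.2]
  rw [abs_mul, abs_of_pos (mul_pos hd0 (by linarith : (0 : ℝ) < 1 - t))] at h3
  have h4 : d * (1 / 2) * |greenFunction G z y| ≤ d * (1 - t) * |greenFunction G z y| := by
    gcongr
    linarith
  have h5 : d * |greenFunction G z y|
      ≤ d * (4 * (J + 2) / Fintype.card V + 4 * β⁻¹ * X) := by
    calc d * |greenFunction G z y| ≤ 2 * (2 * (d * β⁻¹ * X) + d * (2 * (J + 2) / Fintype.card V)) :=
          by linarith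
      _ = _ := by ring
  exact le_of_mul_le_mul_left h5 hd0

end NonBacktracking

end ZeroAvgGFF

namespace ZeroAvgGFF

/-! ### The Green function near a good boundary vertex -/

section GoodVertex

variable {V : Type*} {G : SimpleGraph V}

theorem localComponent_subset {A : Set V} {x : V} {s : ℕ} :
    localComponent G A x s ⊆ nbhd G A s \ A :=
  fun _ ⟨w, hw⟩ => hw _ w.start_mem_support

theorem mem_localComponent_of_adj {A : Set V} {x z w : V} {s : ℕ}
    (hz : z ∈ localComponent G A x s) (h : G.Adj w z) (hw : w ∈ nbhd G A s \ A) :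
    w ∈ localComponent G A x s := by
  obtain ⟨p, hp⟩ := hz
  refine ⟨.cons h p, fun v hv => ?_⟩
  rw [SimpleGraph.Walk.support_cons, List.mem_cons] at hv
  rcases hv with rfl | hv
  · exact hw
  · exact hp v hv

theorem connected_induce_localComponent {A : Set V} {x : V} {s : ℕ}
    (hx : x ∈ localComponent G A x s) : (G.induce (localComponent G A x s)).Connected := by
  classical
  rw [SimpleGraph.connected_iff_exists_forall_reachable]
  refine ⟨⟨x, hx⟩, fun ⟨y, hy⟩ => ?_⟩
  have hy' := hy
  obtain ⟨w, hw⟩ := hy'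
  have p : (G.induce (localComponent G A x s)).Walk ⟨y, hy⟩ ⟨x, hx⟩ :=
    w.induce (localComponent G A x s) fun v hv =>
    ⟨w.dropUntil v hv, fun v' hv' => hw v' (w.support_dropUntil_subset_support hv hv')⟩
  exact p.reachable.symm

namespace IsGoodBoundaryVertex

variable {s : ℕ} {A : Set V} {x : V}

theorem mem_localComponent (h : IsGoodBoundaryVertex G s A x) (hs : 1 ≤ s) :
    x ∈ localComponent G A x s := by
  obtain ⟨hxA, a, ha, hax⟩ := h.mem_boundary
  refine ⟨.nil, fun v hv => ?_⟩
  rw [SimpleGraph.Walk.support_nil, List.mem_singleton] at hv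
  subst hv
  exact ⟨⟨a, ha, closedBall_mono hs (mem_closedBall_one hax)⟩, hxA⟩

/-- Vertices of the local component reach `x` without leaving `B(A, s)` or meeting `A`, so
separation leaves `x` as the only one that can touch `A`. -/
theorem eq_of_adj (h : IsGoodBoundaryVertex G s A x) {xbar : V}
    (hbar : closedBall G x 1 ∩ A = {xbar}) {z a : V} (hz : z ∈ localComponent G A x s)
    (ha : a ∈ A) (hza : G.Adj z a) : z = x ∧ a = xbar := by
  have hzx : z = x := by
    by_contra hne
    have hzA := (localComponent_subset hz).2
    obtain ⟨w, hw⟩ := hz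
    obtain ⟨v, hv, hv'⟩ := h.separated z ⟨⟨hzA, a, ha, hza.symm⟩, hne⟩ w fun v hv => (hw v hv).2
    exact hv' (hw v hv).1
  subst hzx
  exact ⟨rfl, by rw [← Set.mem_singleton_iff, ← hbar]; exact ⟨mem_closedBall_one hza, ha⟩⟩

theorem isTree (h : IsGoodBoundaryVertex G s A x) [Finite V] (hs : 1 ≤ s) :
    (G.induce (localComponent G A x s)).IsTree :=
  isTree_induce_of_treeExcess_eq_zero (connected_induce_localComponent (h.mem_localComponent hs))
    h.treeLike

end IsGoodBoundaryVertex

theorem adj_of_closedBall_inter_eq {A : Set V} {x xbar : V} (hx : x ∉ A)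
    (hbar : closedBall G x 1 ∩ A = {xbar}) : xbar ∈ A ∧ G.Adj x xbar := by
  have h : xbar ∈ closedBall G x 1 ∩ A := by rw [hbar]; rfl
  refine ⟨h.2, ?_⟩
  have h1 : G.edist x xbar ≤ (1 : ℕ) := h.1
  rw [Nat.cast_one, SimpleGraph.edist_le_one_iff_adj_or_eq] at h1
  exact h1.resolve_right fun he => hx (he ▸ h.2)

variable [Fintype V] [DecidableEq V] [DecidableRel G.Adj]

open Classical in
/-- The function decaying by a factor `t` at every step away from the root of a tree. -/
theorem exists_geometric_function {F : Set V} (hF : (G.induce F).IsTree) {x : V} (hx : x ∈ F)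
    {t : ℝ} (ht0 : 0 < t) (ht1 : t ≤ 1) :
    ∃ h : V → ℝ, (∀ z, 0 ≤ h z) ∧ (∀ z, h z ≤ 1) ∧ (∀ z, z ∉ F → h z = 0) ∧ h x = t ∧
      ∀ w ∈ F, ∑ v ∈ G.neighborFinset w, h v
        = ((G.neighborFinset w).filter (· ∈ F)).card * (t * h w)
          + if w = x then 0 else t⁻¹ * h w - t * h w := by
  obtain ⟨f, hfr, hf1, hf2⟩ := exists_parent hF ⟨x, hx⟩
  set l : F → ℕ := fun z => (G.induce F).dist ⟨x, hx⟩ z with hl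
  refine ⟨fun z => if hz : z ∈ F then t ^ (l ⟨z, hz⟩ + 1) else 0, fun z => ?_, fun z => ?_,
    fun z hz => by simp [hz], by simp [hx, hl], fun w hw => ?_⟩
  · dsimp only
    split_ifs <;> positivity
  · dsimp only
    split_ifs
    · exact pow_le_one₀ ht0.le ht1
    · exact zero_le_one
  set h : V → ℝ := fun z => if hz : z ∈ F then t ^ (l ⟨z, hz⟩ + 1) else 0 with hh
  have hsum : ∑ v ∈ G.neighborFinset w, h v = ∑ v ∈ (G.neighborFinset w).filter (· ∈ F), h v := by
    rw [Finset.sum_filter]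
    exact Finset.sum_congr rfl fun v _ => by split_ifs with hv <;> simp [hh, hv]
  have hchild : ∀ v (hv : v ∈ F), G.Adj w v → v ≠ f ⟨w, hw⟩ → h v = t * h w := by
    intro v hv hwv hne
    rcases hf2 ⟨w, hw⟩ ⟨v, hv⟩ hwv with ⟨h1, -⟩ | ⟨-, h1⟩
    · exact absurd (congrArg Subtype.val h1) hne
    · have : l ⟨v, hv⟩ = l ⟨w, hw⟩ + 1 := h1
      simp only [hh, dif_pos hv, dif_pos hw, this]
      ring
  rw [hsum]
  by_cases hwx : w = x
  · subst hwx
    rw [if_pos rfl, add_zero, Finset.sum_congr rfl (g := fun _ => t * h w), Finset.sum_const,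
      nsmul_eq_mul]
    intro v hv
    rw [Finset.mem_filter, SimpleGraph.mem_neighborFinset] at hv
    refine hchild v hv.2 hv.1 ?_
    rw [hfr]
    exact hv.1.ne'
  · rw [if_neg hwx]
    obtain ⟨h1, h2⟩ := hf1 ⟨w, hw⟩ fun he => hwx (congrArg Subtype.val he)
    set p := f ⟨w, hw⟩ with hp
    have hpm : (p : V) ∈ (G.neighborFinset w).filter (· ∈ F) := by
      rw [Finset.mem_filter, SimpleGraph.mem_neighborFinset]
      exact ⟨h1, p.2⟩
    have hpv : h p = t⁻¹ * h w := by
      have : l ⟨w, hw⟩ = l p + 1 := h2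
      simp only [hh, dif_pos hw, dif_pos p.2, this, Subtype.coe_eta]
      field_simp
      ring
    rw [← Finset.sum_erase_add _ _ hpm, hpv, Finset.sum_congr rfl (g := fun _ => t * h w),
      Finset.sum_const, nsmul_eq_mul, Finset.card_erase_of_mem hpm,
      Nat.cast_sub (Finset.card_pos.2 ⟨_, hpm⟩)]
    · push_cast
      ring
    · intro v hv
      rw [Finset.mem_erase, Finset.mem_filter, SimpleGraph.mem_neighborFinset] at hv
      exact hchild v hv.2.2 hv.2.1 hv.1

/-- At a good boundary vertex `x`, the function `G(·, x) - G(·, xbar) / (d - 1)` is, on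
`A ∪ {x}`, close to the Green function of the tree killed on `A`. -/
theorem IsGoodBoundaryVertex.abs_green_sub_le {d : ℕ} (hd : 3 ≤ d)
    (hreg : G.IsRegularOfDegree d) {β : ℝ} {u : V → V → ℝ} {μ : V → ℝ}
    (hG : IsGreenEigensystem G d β u μ) {s : ℕ} (hs : 1 ≤ s) {A : Finset V} {x xbar : V}
    (hgood : IsGoodBoundaryVertex G s (A : Set V) x)
    (hbar : closedBall G x 1 ∩ (A : Set V) = {xbar}) {y : V} (hy : y ∈ A ∨ y = x) {M : ℝ}
    (hM : ∀ w, w ∉ nbhd G (A : Set V) s →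
      |greenFunction G y w| ≤ M ∧ ∀ z, G.Adj z w → |greenFunction G y z| ≤ M) :
    |greenFunction G y x - (d - 1 : ℝ)⁻¹ * greenFunction G y xbar
        - (if y = x then (d : ℝ) / (d - 1) else 0)|
      ≤ 2 * M + d * (A.card * (d + 1) ^ s / Fintype.card V) := by
  classical
  have hd' : (3 : ℝ) ≤ d := by exact_mod_cast hd
  have hd1 : (0 : ℝ) < d - 1 := by linarith
  set t : ℝ := (d - 1 : ℝ)⁻¹ with ht
  have ht0 : 0 < t := inv_pos.2 hd1
  have htd : t * (d - 1) = 1 := inv_mul_cancel₀ hd1.ne'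
  have ht1 : t ≤ 1 / 2 := by nlinarith
  have htinv : t⁻¹ = d - 1 := inv_inv _
  set F := localComponent G (A : Set V) x s with hF
  have hxF : x ∈ F := hgood.mem_localComponent hs
  have hxA : x ∉ A := hgood.mem_boundary.1
  obtain ⟨hbarA, hxbar⟩ := adj_of_closedBall_inter_eq hgood.mem_boundary.1 hbar
  have hFA : ∀ {z}, z ∈ F → z ∉ A := fun hz => (localComponent_subset hz).2
  obtain ⟨h, hh0, hh1, hhF, hhx, hhsum⟩ :=
    exists_geometric_function (hgood.isTree hs) hxF ht0 (by linarith)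
  -- For `z ∈ F`, the set `O z` consists of the neighbours through which one leaves `B(A, s)`, as
  -- any neighbour in `B(A, s) \ A` would belong to `F`.
  set O : V → Finset V := fun z => (G.neighborFinset z).filter fun w => w ∉ F ∧ w ∉ A with hO
  have hadjA : ∀ w, w ∈ A → ∑ v ∈ G.neighborFinset w, h v = if w = xbar then t else 0 := by
    intro w hw
    have h0 : ∀ v ∈ G.neighborFinset w, v ≠ x → h v = 0 := by
      intro v hv hne
      refine hhF v fun hvF => hne (hgood.eq_of_adj hbar hvF hw ?_).1
      exact ((G.mem_neighborFinset w v).1 hv).symm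
    split_ifs with hwx
    · subst hwx
      rw [Finset.sum_eq_single_of_mem x ((G.mem_neighborFinset _ _).2 hxbar.symm) h0, hhx]
    · refine Finset.sum_eq_zero fun v hv => h0 v hv ?_
      rintro rfl
      exact hwx (hgood.eq_of_adj hbar hxF hw ((G.mem_neighborFinset w v).1 hv).symm).2
  have hcard : ∀ w ∈ F, (((G.neighborFinset w).filter (· ∈ F)).card : ℝ)
      = d - (O w).card - if w = x then 1 else 0 := by
    intro w hw
    have h1 : ((G.neighborFinset w).filter (· ∈ A)).card = if w = x then 1 else 0 := by
      split_ifs with hwx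
      · rw [Finset.card_eq_one]
        refine ⟨xbar, Finset.ext fun a => ?_⟩
        rw [Finset.mem_filter, SimpleGraph.mem_neighborFinset, Finset.mem_singleton]
        subst hwx
        exact ⟨fun ha => (hgood.eq_of_adj hbar hw ha.2 ha.1).2, fun ha => ha ▸ ⟨hxbar, hbarA⟩⟩
      · rw [Finset.card_eq_zero, Finset.filter_eq_empty_iff]
        intro a ha haA
        exact hwx (hgood.eq_of_adj hbar hw haA ((G.mem_neighborFinset w a).1 ha)).1
    have h2 := Finset.card_filter_add_card_filter_not (s := G.neighborFinset w) (· ∈ F)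
    have h3 := Finset.card_filter_add_card_filter_not
      (s := (G.neighborFinset w).filter (· ∉ F)) (· ∈ A)
    rw [Finset.filter_filter, Finset.filter_filter] at h3
    have h4 : (G.neighborFinset w).filter (fun a => a ∉ F ∧ a ∈ A)
        = (G.neighborFinset w).filter (· ∈ A) :=
      Finset.filter_congr fun a _ => ⟨fun ha => ha.2, fun ha => ⟨fun hf => hFA hf ha, ha⟩⟩
    rw [h4, h1] at h3
    rw [SimpleGraph.card_neighborFinset_eq_degree, hreg w] at h2
    have h5 : (((G.neighborFinset w).filter (· ∈ F)).card : ℝ)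
        + ((if w = x then 1 else 0 : ℕ) + (O w).card : ℕ) = d := by
      rw [h3]
      exact_mod_cast h2
    push_cast at h5
    linarith
  -- Decay by `t` makes `h` harmonic at full-degree tree vertices. The normalisation `h x = t` gives
  -- unit source at `x` and `-t` at `xbar`; the rest comes from edges leaving `F` away from `A`.
  have hlap : ∀ w, d * h w - ∑ v ∈ G.neighborFinset w, h v
      = (if w = x then 1 else 0) - (if w = xbar then t else 0) + t * (h w * (O w).card)
        - (if w ∉ F ∧ w ∉ A then 1 else 0) * ∑ v ∈ G.neighborFinset w, h v := by
    intro w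
    by_cases hwF : w ∈ F
    · have hwb : w ≠ xbar := fun he => hFA hwF (he ▸ hbarA)
      rw [hhsum w hwF, hcard w hwF, htinv, if_neg hwb,
        if_neg (show ¬(w ∉ F ∧ w ∉ A) from fun hc => hc.1 hwF)]
      split_ifs with hwx
      · subst hwx
        rw [hhx]
        linear_combination (1 - t) * htd
      · linear_combination (-h w) * htd
    · have hwx : w ≠ x := fun he => hwF (he ▸ hxF)
      by_cases hwA : w ∈ A
      · rw [hadjA w hwA, hhF w hwF, if_neg hwx,
          if_neg (show ¬(w ∉ F ∧ w ∉ A) from fun hc => hc.2 hwA)]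
        ring
      · have hwb : w ≠ xbar := fun he => hwA (he ▸ hbarA)
        rw [hhF w hwF, if_neg hwx, if_neg hwb, if_pos ⟨hwF, hwA⟩]
        ring
  have hident : ∀ g : V → ℝ, ∑ w, g w * (d * h w - ∑ v ∈ G.neighborFinset w, h v)
      = g x - t * g xbar + ∑ z, h z * ∑ w ∈ O z, (t * g z - g w) := by
    intro g
    have h1 : ∑ w, g w * ((if w ∉ F ∧ w ∉ A then 1 else 0) * ∑ v ∈ G.neighborFinset w, h v)
        = ∑ z, h z * ∑ w ∈ O z, g w := by
      simp_rw [← mul_assoc]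
      rw [sum_neighborFinset_comm]
      refine Finset.sum_congr rfl fun z _ => ?_
      rw [mul_comm, Finset.sum_filter]
      congr 1
      exact Finset.sum_congr rfl fun w _ => by split_ifs <;> simp
    simp_rw [hlap, mul_sub, mul_add, Finset.sum_sub_distrib, Finset.sum_add_distrib, mul_sub,
      Finset.sum_sub_distrib, h1]
    simp only [mul_ite, mul_one, mul_zero, Finset.sum_ite_eq', Finset.mem_univ, if_true,
      Finset.sum_const, nsmul_eq_mul]
    have h2 : ∑ w, g w * (t * (h w * (O w).card)) = ∑ w, h w * ((O w).card * (t * g w)) :=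
      Finset.sum_congr rfl fun w _ => by ring
    rw [h2]
    ring
  -- Testing against the constant function annihilates the Laplacian and shows that the flux through
  -- the exit edges is one, so the number of exits does not enter the error.
  have hmass : ∑ z, h z * (O z).card = 1 := by
    have h1 := hident fun _ => 1
    have h2 := sum_neighborFinset_comm G (fun _ => 1) h
    simp only [one_mul, Finset.sum_const, nsmul_eq_mul, mul_one,
      SimpleGraph.card_neighborFinset_eq_degree, hreg _] at h2
    simp only [one_mul, mul_one, Finset.sum_sub_distrib, h2, sub_self, Finset.sum_const,
      nsmul_eq_mul] at h1
    have h4 : ∑ z, h z * ((O z).card * t - (O z).card) = (t - 1) * ∑ z, h z * (O z).card := by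
      rw [Finset.mul_sum]
      exact Finset.sum_congr rfl fun z _ => by ring
    rw [h4] at h1
    have h3 : (1 - t) * (1 - ∑ z, h z * (O z).card) = 0 := by linarith
    rcases mul_eq_zero.1 h3 with h4 | h4 <;> linarith
  have hout : |∑ z, h z * ∑ w ∈ O z, (t * greenFunction G y z - greenFunction G y w)| ≤ 2 * M := by
    calc _ ≤ ∑ z, |h z * ∑ w ∈ O z, (t * greenFunction G y z - greenFunction G y w)| :=
          Finset.abs_sum_le_sum_abs _ _
      _ ≤ ∑ z, h z * ((O z).card * (2 * M)) := by
          refine Finset.sum_le_sum fun z _ => ?_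
          rw [abs_mul, abs_of_nonneg (hh0 z)]
          by_cases hzF : z ∈ F
          swap
          · simp [hhF z hzF]
          refine mul_le_mul_of_nonneg_left ?_ (hh0 z)
          refine (Finset.abs_sum_le_sum_abs _ _).trans ?_
          rw [← nsmul_eq_mul]
          refine Finset.sum_le_card_nsmul _ _ _ fun w hw => ?_
          rw [Finset.mem_filter, SimpleGraph.mem_neighborFinset] at hw
          have hwn : w ∉ nbhd G (A : Set V) s := fun hc =>
            hw.2.1 (mem_localComponent_of_adj hzF hw.1.symm ⟨hc, hw.2.2⟩)
          have h1 := (hM w hwn).1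
          have h2 := (hM w hwn).2 z hw.1
          refine (abs_sub _ _).trans ?_
          rw [abs_mul, abs_of_pos ht0]
          nlinarith [abs_nonneg (greenFunction G y z)]
      _ = (∑ z, h z * (O z).card) * (2 * M) := by
          rw [Finset.sum_mul]
          exact Finset.sum_congr rfl fun z _ => by ring
      _ = 2 * M := by rw [hmass, one_mul]
  -- The left side of the Laplacian identity at `y` is the tree value: `h` vanishes on `A`, and `d *
  -- t = d / (d-1)` at `x`.
  have hhy : d * h y = if y = x then (d : ℝ) / (d - 1) else 0 := by
    rcases hy with hy | rfl
    · rw [hhF y fun hc => hFA hc hy, if_neg (show y ≠ x from fun he => hxA (he ▸ hy)),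
        mul_zero]
    · rw [if_pos rfl, hhx, ht, div_eq_mul_inv]
  have htot : ∑ w, h w ≤ A.card * (d + 1) ^ s := by
    have hb : ∀ a ∈ A, ∃ S : Finset V, closedBall G a s ⊆ S ∧ S.card ≤ (d + 1) ^ s :=
      fun a _ => exists_finset_closedBall_subset hreg a s
    choose! S hS1 hS2 using hb
    have hFS : ∀ w, w ∉ A.biUnion S → h w = 0 := by
      intro w hw
      refine hhF w fun hwF => hw ?_
      obtain ⟨a, ha, haw⟩ := (localComponent_subset hwF).1
      exact Finset.mem_biUnion.2 ⟨a, ha, hS1 a ha haw⟩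
    calc ∑ w, h w = ∑ w ∈ A.biUnion S, h w :=
          (Finset.sum_subset (Finset.subset_univ _) fun w _ hw => hFS w hw).symm
      _ ≤ (A.biUnion S).card := by
          simpa using Finset.sum_le_card_nsmul (A.biUnion S) h 1 fun w _ => hh1 w
      _ ≤ ((A.card * (d + 1) ^ s : ℕ) : ℝ) := by
          exact_mod_cast Finset.card_biUnion_le_card_mul _ _ _ hS2
      _ = _ := by push_cast; ring
  have hfin := hG.sum_green_mul_laplacian (by omega) h y
  rw [hident, mul_sub, hhy] at hfin
  have hN0 : 0 ≤ d * ((∑ w, h w) / Fintype.card V) :=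
    mul_nonneg (by linarith) (div_nonneg (Finset.sum_nonneg fun w _ => hh0 w) (by positivity))
  have hN1 : d * ((∑ w, h w) / Fintype.card V) ≤ d * (A.card * (d + 1) ^ s / Fintype.card V) := by
    gcongr
  rw [abs_le] at hout ⊢
  constructor <;> linarith [hout.1, hout.2]

end GoodVertex

end ZeroAvgGFF

namespace ZeroAvgGFF

/-! ### Gaussian regression -/

section Conditioning

variable {V : Type*} [Fintype V]

omit [Fintype V] in
theorem cylinderEvents_le_comap_restrict (A : Finset V) :
    cylinderEvents (X := fun _ : V => ℝ) (A : Set V)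
      ≤ MeasurableSpace.comap (fun (φ : V → ℝ) (z : A) => φ z) inferInstance := by
  refine iSup₂_le fun i hi => ?_
  have h : (fun φ : V → ℝ => φ i)
      = (fun ψ : A → ℝ => ψ ⟨i, hi⟩) ∘ fun (φ : V → ℝ) (z : A) => φ z := rfl
  rw [h, ← MeasurableSpace.comap_comp]
  exact MeasurableSpace.comap_mono (measurable_pi_apply _).comap_le

variable {P : Measure (V → ℝ)} [IsGaussian P] {S : V → V → ℝ}

theorem memLp_two_eval (x : V) : MemLp (fun φ : V → ℝ => φ x) 2 P :=
  (IsGaussian.hasGaussianLaw_id.map_fun (ContinuousLinearMap.proj (R := ℝ)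
    (φ := fun _ : V => ℝ) x)).memLp_two

/-- Regression for a centred Gaussian vector: if `a` solves the normal equations, then the
residual is centred, independent of the conditioning, and has the Schur complement as variance. -/
theorem condExp_condVar_eval (hmean : ∀ x, ∫ φ, φ x ∂P = 0)
    (hcov : ∀ x y, cov[fun φ : V → ℝ => φ x, fun φ => φ y; P] = S x y) (A : Finset V) (x : V)
    (a : V → ℝ) (ha : ∀ y ∈ A, ∑ z ∈ A, a z * S z y = S x y) :
    (P[fun φ : V → ℝ => φ x | cylinderEvents (X := fun _ : V => ℝ) (A : Set V)]
        =ᵐ[P] fun φ => ∑ z ∈ A, a z * φ z) ∧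
      Var[fun φ : V → ℝ => φ x ; P | cylinderEvents (X := fun _ : V => ℝ) (A : Set V)]
        =ᵐ[P] fun _ => S x x - ∑ z ∈ A, a z * S z x := by
  have hle : cylinderEvents (X := fun _ : V => ℝ) (A : Set V) ≤ MeasurableSpace.pi := cylinderEvents_le_pi
  have hL2 : ∀ z, MemLp (fun φ : V → ℝ => φ z) 2 P := fun z => memLp_two_eval z
  have hI : ∀ z, Integrable (fun φ : V → ℝ => φ z) P := fun z => (hL2 z).integrable one_le_two
  set W : (V → ℝ) → ℝ := fun φ => ∑ z ∈ A, a z * φ z with hW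
  set Z : (V → ℝ) → ℝ := fun φ => φ x - W φ with hZ
  have hWL2 : MemLp W 2 P := memLp_finsetSum _ fun z _ => (hL2 z).const_mul (a z)
  have hZL2 : MemLp Z 2 P := (hL2 x).sub hWL2
  have hWm : StronglyMeasurable[cylinderEvents (X := fun _ : V => ℝ) (A : Set V)] W := by
    refine (Finset.measurable_fun_sum A fun z hz => ?_).stronglyMeasurable
    exact (measurable_cylinderEvent_apply (X := fun _ : V => ℝ) hz).const_mul (a z)
  have hcovZ : ∀ y, cov[Z, fun φ : V → ℝ => φ y; P] = S x y - ∑ z ∈ A, a z * S z y := by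
    intro y
    rw [hZ, covariance_fun_sub_left (hL2 x) hWL2 (hL2 y), hcov, hW,
      covariance_fun_sum_left' (fun z _ => (hL2 z).const_mul (a z)) (hL2 y)]
    simp_rw [covariance_const_mul_left, hcov]
  have hZW : cov[Z, W; P] = 0 := by
    rw [hW, covariance_fun_sum_right' (fun z _ => (hL2 z).const_mul (a z)) hZL2]
    refine Finset.sum_eq_zero fun z hz => ?_
    rw [covariance_const_mul_right, hcovZ, ha z hz, sub_self, mul_zero]
  have hZmean : ∫ φ, Z φ ∂P = 0 := by
    rw [hZ, integral_sub (hI x) (hWL2.integrable one_le_two), hmean, hW,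
      integral_finsetSum _ fun z _ => (hI z).const_mul (a z)]
    simp [integral_const_mul, hmean]
  have hZsq : ∫ φ, Z φ ^ 2 ∂P = S x x - ∑ z ∈ A, a z * S z x := by
    have h1 : cov[Z, Z; P] = cov[Z, fun φ : V → ℝ => φ x; P] := by
      nth_rewrite 2 [hZ]
      rw [covariance_fun_sub_right hZL2 (hL2 x) hWL2, hZW, sub_zero]
    rw [← hcovZ, ← h1, covariance_eq_sub hZL2 hZL2, hZmean]
    simp [sq]
  -- The residual and the conditioning vector form a linear image of the field, hence are jointly
  -- Gaussian, and vanishing covariance gives independence. The index type `Unit` merely presents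
  -- the scalar residual as a vector.
  have hind : IndepFun Z (fun (φ : V → ℝ) (z : A) => φ z) P := by
    have hL : HasGaussianLaw (fun φ : V → ℝ => ((fun _ : Unit => Z φ), fun z : A => φ z)) P := by
      let L : (V → ℝ) →L[ℝ] (Unit → ℝ) × (A → ℝ) := LinearMap.toContinuousLinearMap
        { toFun := fun φ => ((fun _ : Unit => Z φ), fun z : A => φ z)
          map_add' := by
            intro φ ψ
            ext <;> simp [hZ, hW, mul_add, Finset.sum_add_distrib]
            ring
          map_smul' := by
            intro c φ
            ext <;> simp [hZ, hW, mul_sub, Finset.mul_sum, mul_left_comm] }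
      exact IsGaussian.hasGaussianLaw_id.map_fun L
    have h := HasGaussianLaw.indepFun_of_covariance_eval (X := fun _ : Unit => Z)
      (Y := fun (z : A) (φ : V → ℝ) => φ z) hL fun _ z => by
        rw [hcovZ, ha z z.2, sub_self]
    exact h.comp (measurable_pi_apply ()) measurable_id
  have hZmeas : Measurable Z := by
    have : Measurable W := hWm.measurable.mono hle le_rfl
    exact (measurable_pi_apply x).sub this
  have hindep : ∀ g : ℝ → ℝ, Measurable g → P[fun φ => g (Z φ) |
        cylinderEvents (X := fun _ : V => ℝ) (A : Set V)] =ᵐ[P] fun _ => ∫ φ, g (Z φ) ∂P := by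
    intro g hg
    refine condExp_indep_eq (m₁ := MeasurableSpace.comap Z inferInstance) hZmeas.comap_le hle
      (hg.comp (comap_measurable Z)).stronglyMeasurable ?_
    exact indep_of_indep_of_le_right hind (cylinderEvents_le_comap_restrict A)
  have hE : P[fun φ : V → ℝ => φ x |
        cylinderEvents (X := fun _ : V => ℝ) (A : Set V)] =ᵐ[P] W := by
    have h1 : (fun φ : V → ℝ => φ x) = (fun φ => Z φ) + W := by
      ext φ
      simp [hZ]
    rw [h1]
    have h2 := hindep id measurable_id
    simp only [id_eq, hZmean] at h2
    filter_upwards [condExp_add (hZL2.integrable one_le_two) (hWL2.integrable one_le_two)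
      (cylinderEvents (X := fun _ : V => ℝ) (A : Set V)), h2]
      with φ h3 h4
    rw [h3, Pi.add_apply, h4, zero_add,
      condExp_of_stronglyMeasurable hle hWm (hWL2.integrable one_le_two)]
  refine ⟨hE, ?_⟩
  have h1 : ((fun φ : V → ℝ => φ x) - P[fun φ : V → ℝ => φ x |
        cylinderEvents (X := fun _ : V => ℝ) (A : Set V)]) ^ 2 =ᵐ[P] fun φ => Z φ ^ 2 := by
    filter_upwards [hE] with φ hφ
    simp [hφ, hZ]
  refine (condExp_congr_ae h1).trans ?_
  have h2 := hindep (· ^ 2) (by fun_prop)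
  simp only [hZsq] at h2
  exact h2

end Conditioning

/-! ### Mean and covariance of the field -/

section FieldLaw

variable {V : Type*} [Fintype V] [DecidableEq V] (G : SimpleGraph V) [DecidableRel G.Adj]

theorem fieldLaw_eq_map : fieldLaw G = (multivariateGaussian (0 : EuclideanSpace ℝ V)
    (greenFunction G)).map (EuclideanSpace.equiv V ℝ : EuclideanSpace ℝ V →L[ℝ] V → ℝ) := rfl

instance isGaussian_fieldLaw : IsGaussian (fieldLaw G) := by
  rw [fieldLaw_eq_map]
  infer_instance

theorem integral_eval_fieldLaw (x : V) : ∫ φ, φ x ∂(fieldLaw G) = 0 := by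
  rw [fieldLaw, integral_map (f := fun φ : V → ℝ => φ x) (by fun_prop)
    (measurable_pi_apply x).aestronglyMeasurable]
  have h : (fun v : EuclideanSpace ℝ V => v x) = fun v => EuclideanSpace.proj (𝕜 := ℝ) x v := rfl
  rw [h, ContinuousLinearMap.integral_comp_comm _ IsGaussian.integrable_fun_id]
  simp

variable {G}

theorem covariance_eval_fieldLaw (hG : (greenFunction G).PosSemidef) (x y : V) :
    cov[fun φ : V → ℝ => φ x, fun φ => φ y; fieldLaw G] = greenFunction G x y := by
  rw [fieldLaw, covariance_map_fun (measurable_pi_apply x).aestronglyMeasurable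
    (measurable_pi_apply y).aestronglyMeasurable (by fun_prop)]
  exact covariance_eval_multivariateGaussian hG x y

end FieldLaw

end ZeroAvgGFF

namespace ZeroAvgGFF

/-! ### Perturbation of the normal equations -/

section NormalEquations

variable {V : Type*} [Fintype V] [DecidableEq V] {G : SimpleGraph V} [DecidableRel G.Adj]
  {d : ℕ} {β : ℝ} {u : V → V → ℝ} {μ : V → ℝ}

namespace IsGreenEigensystem

/-- After extension of `v` by zero, the constant mode is controlled by Cauchy–Schwarz on `A` and
costs only the fraction `|A| / N`. -/
theorem coercive_on (hG : IsGreenEigensystem G d β u μ) (hβ : 0 < β) (A : Finset V)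
    (v : V → ℝ) :
    (1 - A.card / Fintype.card V) / 2 * ∑ z ∈ A, v z ^ 2
      ≤ ∑ z ∈ A, v z * ∑ w ∈ A, v w * greenFunction G w z := by
  have h := hG.le_sum_sum_green_mul hβ fun z => if z ∈ A then v z else 0
  simp only [ite_pow, ne_eq, OfNat.ofNat_ne_zero, not_false_eq_true, zero_pow, mul_ite, mul_zero,
    ite_mul, zero_mul, Finset.sum_ite_mem, Finset.univ_inter] at h
  have h1 : (∑ z ∈ A, v z) ^ 2 / Fintype.card V
      ≤ A.card / Fintype.card V * ∑ z ∈ A, v z ^ 2 := by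
    rw [div_mul_eq_mul_div]
    gcongr
    exact sq_sum_le_card_mul_sum_sq
  have h2 : ∑ z ∈ A, v z * ∑ w ∈ A, v w * greenFunction G w z
      = ∑ z ∈ A, v z * ∑ w ∈ A, greenFunction G z w * v w :=
    Finset.sum_congr rfl fun z _ => by
      congr 1
      exact Finset.sum_congr rfl fun w _ => by rw [hG.green_comm w z, mul_comm]
  rw [h2]
  linarith

/-- Coercivity makes the restricted matrix injective, hence invertible; testing the solution against
itself gives the norm bound. -/
theorem exists_normal_equations (hG : IsGreenEigensystem G d β u μ) (hβ : 0 < β) (A : Finset V)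
    {κ : ℝ} (hκ : 0 < κ) (hκA : κ ≤ 1 - A.card / Fintype.card V) (r : V → ℝ) :
    ∃ δ : V → ℝ, (∀ y ∈ A, ∑ z ∈ A, δ z * greenFunction G z y = r y) ∧
      √(∑ z ∈ A, δ z ^ 2) ≤ 2 / κ * √(∑ z ∈ A, r z ^ 2) := by
  have hco : ∀ v : V → ℝ, κ / 2 * ∑ z ∈ A, v z ^ 2
      ≤ ∑ z ∈ A, v z * ∑ w ∈ A, v w * greenFunction G w z := fun v =>
    le_trans (by gcongr) (hG.coercive_on hβ A v)
  let T : (A → ℝ) →ₗ[ℝ] (A → ℝ) :=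
    (Matrix.of fun y z : A => greenFunction G z y).mulVecLin
  have hT : ∀ (v : V → ℝ) (y : A), T (fun z : A => v z) y
      = ∑ z ∈ A, v z * greenFunction G z y := by
    intro v y
    rw [← Finset.sum_coe_sort A]
    simp [T, Matrix.mulVec, dotProduct, mul_comm]
  have hinj : Function.Injective T := by
    rw [injective_iff_map_eq_zero]
    intro v hv
    set v' : V → ℝ := fun z => if h : z ∈ A then v ⟨z, h⟩ else 0 with hv'
    have hvv : (fun z : A => v' z) = v := by
      ext z
      simp [hv']
    have h1 := hco v'
    rw [Finset.sum_eq_zero (s := A) (f := fun z => v' z * ∑ w ∈ A, v' w * greenFunction G w z)] at h1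
    · have h2 : ∑ z ∈ A, v' z ^ 2 = 0 :=
        le_antisymm (by nlinarith) (Finset.sum_nonneg fun z _ => sq_nonneg _)
      rw [Finset.sum_eq_zero_iff_of_nonneg fun z _ => sq_nonneg _] at h2
      rw [← hvv]
      ext z
      simpa using h2 z z.2
    · intro z hz
      rw [← hT v' ⟨z, hz⟩, hvv, hv]
      simp
  obtain ⟨v, hv⟩ := LinearMap.injective_iff_surjective.1 hinj fun z : A => r z
  set δ : V → ℝ := fun z => if h : z ∈ A then v ⟨z, h⟩ else 0 with hδ
  have hvv : (fun z : A => δ z) = v := by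
    ext z
    simp [hδ]
  have heq : ∀ y ∈ A, ∑ z ∈ A, δ z * greenFunction G z y = r y := by
    intro y hy
    rw [← hT δ ⟨y, hy⟩, hvv, hv]
  refine ⟨δ, heq, ?_⟩
  have h1 := hco δ
  have h0 : ∑ z ∈ A, δ z * ∑ w ∈ A, δ w * greenFunction G w z = ∑ z ∈ A, δ z * r z :=
    Finset.sum_congr rfl fun z hz => by rw [heq z hz]
  rw [h0] at h1
  have h2 := Real.sum_mul_le_sqrt_mul_sqrt A δ r
  have h3 : ∑ z ∈ A, δ z ^ 2 = √(∑ z ∈ A, δ z ^ 2) ^ 2 :=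
    (Real.sq_sqrt (Finset.sum_nonneg fun z _ => sq_nonneg _)).symm
  set D := √(∑ z ∈ A, δ z ^ 2) with hD
  have hD0 : 0 ≤ D := Real.sqrt_nonneg _
  rw [h3] at h1
  rcases hD0.eq_or_lt with h0 | h0
  · rw [← h0]
    positivity
  · rw [div_mul_eq_mul_div, le_div_iff₀ hκ]
    have : κ / 2 * D ≤ √(∑ z ∈ A, r z ^ 2) := by
      refine le_of_mul_le_mul_right ?_ h0
      calc κ / 2 * D * D = κ / 2 * D ^ 2 := by ring
        _ ≤ _ := h1.trans h2
        _ = _ := mul_comm _ _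
    linarith

theorem ae_condExp_condVar_le (hG : IsGreenEigensystem G d β u μ) (hβ : 0 < β) (hd : 3 ≤ d)
    (A : Finset V) {κ : ℝ} (hκ : 0 < κ) (hκA : κ ≤ 1 - A.card / Fintype.card V) {x xbar : V}
    (hxbar : xbar ∈ A) {ε : ℝ} (hε : 0 ≤ ε)
    (hr : ∀ y ∈ A, |greenFunction G y x - (d - 1 : ℝ)⁻¹ * greenFunction G y xbar| ≤ ε)
    (hrx : |greenFunction G x x - (d - 1 : ℝ)⁻¹ * greenFunction G x xbar - (d : ℝ) / (d - 1)| ≤ ε)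
    {B : ℝ} (hB : 0 ≤ B) :
    ∀ᵐ ψ ∂(fieldLaw G), (∀ z ∈ A, |ψ z| ≤ B) →
      |((fieldLaw G)[fun φ : V → ℝ => φ x |
          cylinderEvents (X := fun _ : V => ℝ) (A : Set V)]) ψ - 1 / ((d : ℝ) - 1) * ψ xbar|
        ≤ 2 / κ * (A.card * ε * B) ∧
      |(Var[fun φ : V → ℝ => φ x ; fieldLaw G |
          cylinderEvents (X := fun _ : V => ℝ) (A : Set V)]) ψ - (d : ℝ) / ((d : ℝ) - 1)|
        ≤ 2 * ε + 2 / κ * (A.card * ε ^ 2) := by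
  have hd' : (3 : ℝ) ≤ d := by exact_mod_cast hd
  have hd1 : (0 : ℝ) < d - 1 := by linarith
  set t : ℝ := (d - 1 : ℝ)⁻¹ with ht
  have ht0 : 0 ≤ t := _root_.inv_nonneg.2 hd1.le
  have ht1 : t ≤ 1 := inv_le_one_of_one_le₀ (by linarith)
  set r : V → ℝ := fun y => greenFunction G y x - t * greenFunction G y xbar with hrdef
  obtain ⟨δ, hδ, hδr⟩ := hG.exists_normal_equations hβ A hκ hκA r
  -- The regression coefficients are the tree solution, a mass `t` at `xbar`, plus the correction
  -- `δ` produced by the residual.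
  set a : V → ℝ := fun z => δ z + if z = xbar then t else 0 with ha
  have hasum : ∀ g : V → ℝ, ∑ z ∈ A, a z * g z = ∑ z ∈ A, δ z * g z + t * g xbar := by
    intro g
    simp [ha, add_mul, Finset.sum_add_distrib, ite_mul, hxbar]
  have hnormal : ∀ y ∈ A, ∑ z ∈ A, a z * greenFunction G z y = greenFunction G x y := by
    intro y hy
    rw [hasum, hδ y hy, hrdef, hG.green_comm xbar y, hG.green_comm x y]
    ring
  have hcardsq : ∀ (v : V → ℝ) (c : ℝ), 0 ≤ c → (∀ y ∈ A, |v y| ≤ c) →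
      √(∑ y ∈ A, v y ^ 2) ≤ √A.card * c := by
    intro v c hc hv
    rw [← Real.sqrt_sq hc, ← Real.sqrt_mul (by positivity)]
    refine Real.sqrt_le_sqrt ?_
    rw [← nsmul_eq_mul]
    exact Finset.sum_le_card_nsmul _ _ _ fun y hy => sq_le_sq' (by linarith [(abs_le.1 (hv y hy)).1])
      (abs_le.1 (hv y hy)).2
  have hR := hcardsq r ε hε hr
  have hinner : ∀ (v : V → ℝ) (c : ℝ), 0 ≤ c → (∀ y ∈ A, |v y| ≤ c) →
      |∑ z ∈ A, δ z * v z| ≤ 2 / κ * (A.card * ε * c) := by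
    intro v c hc hv
    have hv2 := hcardsq v c hc hv
    have h1 : |∑ z ∈ A, δ z * v z| ≤ √(∑ z ∈ A, δ z ^ 2) * √(∑ z ∈ A, v z ^ 2) := by
      refine abs_le_of_sq_le_sq ?_ (by positivity)
      rw [mul_pow, Real.sq_sqrt (by positivity), Real.sq_sqrt (by positivity)]
      exact Finset.sum_mul_sq_le_sq_mul_sq _ _ _
    calc _ ≤ √(∑ z ∈ A, δ z ^ 2) * √(∑ z ∈ A, v z ^ 2) := h1
      _ ≤ (2 / κ * (√A.card * ε)) * (√A.card * c) := by
          gcongr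
          exact hδr.trans (by gcongr)
      _ = 2 / κ * ((√A.card * √A.card) * ε * c) := by ring
      _ = _ := by rw [Real.mul_self_sqrt (by positivity)]
  obtain ⟨hE, hVar⟩ := condExp_condVar_eval (P := fieldLaw G) (integral_eval_fieldLaw G)
    (covariance_eval_fieldLaw (hG.posSemidef hβ)) A x a hnormal
  filter_upwards [hE, hVar] with ψ hψE hψV hψ
  rw [hψE, hψV]
  constructor
  · rw [hasum, one_div, add_sub_cancel_right]
    exact hinner ψ B hB hψ
  -- The normal equation at `xbar` replaces `∑ δ z * g z xbar` by `r xbar`. The correction then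
  -- enters through `∑ δ z * r z`, which is quadratic in `ε`, and two terms of size `ε` remain.
  · have h1 : greenFunction G x x - ∑ z ∈ A, a z * greenFunction G z x - (d : ℝ) / (d - 1)
        = (greenFunction G x x - t * greenFunction G x xbar - (d : ℝ) / (d - 1))
          - ∑ z ∈ A, δ z * r z - t * r xbar := by
      have h2 : ∑ z ∈ A, δ z * greenFunction G z x
          = ∑ z ∈ A, δ z * r z + t * ∑ z ∈ A, δ z * greenFunction G z xbar := by
        rw [Finset.mul_sum, ← Finset.sum_add_distrib]
        exact Finset.sum_congr rfl fun z _ => by rw [hrdef]; ring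
      rw [hasum, h2, hδ xbar hxbar, hG.green_comm xbar x]
      ring
    rw [h1]
    have h3 := hinner r ε hε hr
    have h4 : |t * r xbar| ≤ ε := by
      rw [abs_mul, abs_of_nonneg ht0]
      have := hr xbar hxbar
      calc t * |r xbar| ≤ 1 * ε := by gcongr
        _ = ε := one_mul ε
    calc _ ≤ ε + 2 / κ * (A.card * ε * ε) + ε :=
          (abs_sub _ _).trans (add_le_add ((abs_sub _ _).trans (add_le_add hrx h3)) h4)
      _ = _ := by ring

end IsGreenEigensystem

end NormalEquations

/-! ### Size of the scale for large graphs -/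

section Asymptotics

open Filter

/-- The lower bound on `(d-1)^(s+1)` serves the decay of the Green function, the upper bound on
`(d-1)^s` the volume of `B(A, s)`. The power 21 pays for a volume of order `L^17` together with the
target `L^(-7/2)`. -/
theorem eventually_scale {d : ℕ} (hd : 3 ≤ d) {α b : ℝ} (hα : 0 < α) :
    ∀ᶠ N : ℕ in atTop, 3 ≤ scale d N ∧
      (scale d N : ℝ) ≤ α * Real.logb ((d : ℝ) - 1) N ∧
      ((d : ℝ) - 1) ^ scale d N ≤ Real.logb ((d : ℝ) - 1) N ^ 8 ∧
      Real.logb ((d : ℝ) - 1) N ^ 8 ≤ ((d : ℝ) - 1) ^ (scale d N + 1) ∧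
      Real.log N ^ 21 ≤ N ∧ 2 * b * Real.log N ≤ N ∧ 0 < Real.logb ((d : ℝ) - 1) N := by
  have hd' : (3 : ℝ) ≤ d := by exact_mod_cast hd
  have hd1 : (1 : ℝ) < (d : ℝ) - 1 := by linarith
  have hlog : 0 < Real.log ((d : ℝ) - 1) := Real.log_pos hd1
  have hcast : Tendsto (fun N : ℕ => (N : ℝ)) atTop atTop := tendsto_natCast_atTop_atTop
  have hl : Tendsto (fun N : ℕ => Real.logb ((d : ℝ) - 1) (N : ℝ)) atTop atTop :=
    (Real.tendsto_logb_atTop hd1).comp hcast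
  have hll := (Real.tendsto_logb_atTop hd1).comp hl
  have e1 : ∀ᶠ N : ℕ in atTop, Real.log N ^ 21 ≤ N := by
    have h := hcast.eventually
      ((Real.isLittleO_pow_log_id_atTop (n := 21)).bound (c := 1) one_pos)
    filter_upwards [h] with N hN
    simpa using (le_abs_self _).trans hN
  have e2 : ∀ᶠ N : ℕ in atTop, 2 * b * Real.log N ≤ N := by
    have h := hcast.eventually ((Real.isLittleO_log_id_atTop.const_mul_left (2 * b)).bound
      (c := 1) one_pos)
    filter_upwards [h] with N hN
    simpa using (le_abs_self _).trans hN
  have e3 : ∀ᶠ l : ℝ in atTop, 8 * Real.logb ((d : ℝ) - 1) l ≤ α * l := by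
    filter_upwards [(Real.isLittleO_log_id_atTop.const_mul_left
      (8 / Real.log ((d : ℝ) - 1))).bound (c := α) hα, eventually_ge_atTop 0] with l h h0
    have := (le_abs_self _).trans h
    simp only [id_eq, Real.norm_eq_abs, abs_of_nonneg h0] at this
    calc 8 * Real.logb ((d : ℝ) - 1) l = 8 / Real.log ((d : ℝ) - 1) * Real.log l := by
          rw [Real.logb]; ring
      _ ≤ α * l := this
  filter_upwards [e1, e2, hl.eventually e3, hll.eventually_ge_atTop 1, hl.eventually_gt_atTop 0]
    with N h1 h2 h3 h4 h5
  set l := Real.logb ((d : ℝ) - 1) (N : ℝ) with hl'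
  have h4' : 1 ≤ Real.logb ((d : ℝ) - 1) l := h4
  have hs : scale d N = ⌊8 * Real.logb ((d : ℝ) - 1) l⌋₊ := by
    rw [scale, max_eq_right]
    exact Nat.le_floor (by push_cast; linarith)
  have hpow : ((d : ℝ) - 1) ^ (8 * Real.logb ((d : ℝ) - 1) l) = l ^ 8 := by
    rw [mul_comm, Real.rpow_mul (by linarith), Real.rpow_logb (by linarith) hd1.ne' h5]
    norm_cast
  have hle : (scale d N : ℝ) ≤ 8 * Real.logb ((d : ℝ) - 1) l := by
    rw [hs]
    exact Nat.floor_le (by linarith)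
  have hlt : 8 * Real.logb ((d : ℝ) - 1) l ≤ (scale d N + 1 : ℕ) := by
    rw [hs]
    push_cast
    exact (Nat.lt_floor_add_one _).le
  refine ⟨?_, hle.trans h3, ?_, ?_, h1, h2, h5⟩
  · rw [hs]
    exact Nat.le_floor (by push_cast; linarith)
  · rw [← hpow, ← Real.rpow_natCast]
    exact Real.rpow_le_rpow_of_exponent_le hd1.le hle
  · rw [← hpow, ← Real.rpow_natCast]
    exact Real.rpow_le_rpow_of_exponent_le hd1.le hlt

end Asymptotics

end ZeroAvgGFF

namespace ZeroAvgGFF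

/-! ### The residual in large and in bounded graphs -/

section Bounds

variable {V : Type*} [Fintype V] [DecidableEq V] {G : SimpleGraph V} [DecidableRel G.Adj]
  {d : ℕ} {β : ℝ} {u : V → V → ℝ} {μ : V → ℝ}

omit [DecidableEq V] in
theorem one_le_log_card (hd : 3 ≤ d) (hreg : G.IsRegularOfDegree d) (x : V) :
    1 ≤ Real.log (Fintype.card V) := by
  have h1 : d < Fintype.card V := hreg x ▸ G.degree_lt_card_verts x
  have h2 : ((2 : ℝ) ^ 2) ≤ Fintype.card V := by
    norm_num
    exact_mod_cast (by omega : 4 ≤ Fintype.card V)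
  have h3 := Real.log_le_log (by norm_num) h2
  rw [Real.log_pow] at h3
  push_cast at h3
  linarith [Real.log_two_gt_d9]

theorem IsGoodBoundaryVertex.abs_green_sub_le_of_large (hd : 3 ≤ d)
    (hreg : G.IsRegularOfDegree d) (hβ : 0 < β) (hG : IsGreenEigensystem G d β u μ) {α b : ℝ}
    (hα : 0 < α) (hb : 0 < b)
    (hex : ∀ y : V, treeExcess G
      (closedBall G y ⌊α * Real.logb ((d : ℝ) - 1) (Fintype.card V : ℝ)⌋₊) ≤ 1)
    (h3 : 3 ≤ scale d (Fintype.card V))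
    (hsα : (scale d (Fintype.card V) : ℝ) ≤ α * Real.logb ((d : ℝ) - 1) (Fintype.card V : ℝ))
    (hsup : ((d : ℝ) - 1) ^ scale d (Fintype.card V)
      ≤ Real.logb ((d : ℝ) - 1) (Fintype.card V : ℝ) ^ 8)
    (hslow : Real.logb ((d : ℝ) - 1) (Fintype.card V : ℝ) ^ 8
      ≤ ((d : ℝ) - 1) ^ (scale d (Fintype.card V) + 1))
    (h21 : Real.log (Fintype.card V) ^ 21 ≤ Fintype.card V)
    {A : Finset V} (hA : (A.card : ℝ) ≤ b * Real.log (Fintype.card V)) {x xbar : V}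
    (hgood : IsGoodBoundaryVertex G (scale d (Fintype.card V)) (A : Set V) x)
    (hbar : closedBall G x 1 ∩ (A : Set V) = {xbar}) {y : V} (hy : y ∈ A ∨ y = x) :
    |greenFunction G y x - (d - 1 : ℝ)⁻¹ * greenFunction G y xbar
        - (if y = x then (d : ℝ) / (d - 1) else 0)|
      ≤ (2 * (4 * (α / Real.log ((d : ℝ) - 1))
          + 4 * β⁻¹ * √(α * ((d : ℝ) - 1) ^ 3 * Real.log ((d : ℝ) - 1) ^ 7))
          + d * b / Real.log ((d : ℝ) - 1) ^ 16) / √(Real.log (Fintype.card V)) ^ 7 := by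
  have hd' : (3 : ℝ) ≤ d := by exact_mod_cast hd
  have hd1 : (1 : ℝ) < (d : ℝ) - 1 := by linarith
  have hd0 : (0 : ℝ) < (d : ℝ) - 1 := by linarith
  have hL1 : 1 ≤ Real.log (Fintype.card V) := one_le_log_card hd hreg x
  have hlam : 0 < Real.log ((d : ℝ) - 1) := Real.log_pos hd1
  have hN : (0 : ℝ) < Fintype.card V := by exact_mod_cast Fintype.card_pos_iff.2 ⟨x⟩
  set s := scale d (Fintype.card V) with hs
  set N : ℝ := ((Fintype.card V : ℕ) : ℝ) with hNdef
  set L := Real.log N with hL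
  set lam := Real.log ((d : ℝ) - 1) with hlamdef
  set q := √L with hq
  have hq1 : 1 ≤ q := Real.one_le_sqrt.2 hL1
  have hqL : q ^ 2 = L := Real.sq_sqrt (by linarith)
  have hl : Real.logb ((d : ℝ) - 1) N = L / lam := rfl
  rw [hl] at hsα hsup hslow
  -- The scale is `J + 3`: one step is lost because `x` is at distance one from `A`, one in passing
  -- from an exit vertex to its neighbour, and one because the decay estimate with parameter `J`
  -- requires distance beyond `J + 1`.
  obtain ⟨J, hJ⟩ := Nat.exists_eq_add_of_le' h3
  have hJR : J + 2 ≤ ⌊α * Real.logb ((d : ℝ) - 1) N⌋₊ := by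
    refine (show J + 2 ≤ s by omega).trans (Nat.le_floor ?_)
    rwa [hl]
  have hfar : ∀ y z : V, z ∉ closedBall G y (J + 1) → |greenFunction G y z|
      ≤ 4 * (J + 2) / N + 4 * β⁻¹ * √((J + 3) * ((d - 1 : ℝ)⁻¹) ^ (J + 1)) := by
    intro y z hz
    rw [hG.green_comm]
    exact abs_green_le_of_not_mem_closedBall hd hreg hβ hG hJR (hex y) hz
  set M := 4 * (J + 2) / N + 4 * β⁻¹ * √((J + 3) * ((d - 1 : ℝ)⁻¹) ^ (J + 1)) with hM
  have hxbar := adj_of_closedBall_inter_eq hgood.mem_boundary.1 hbar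
  have hnotmem : ∀ w, w ∉ nbhd G (A : Set V) s → w ∉ closedBall G y (J + 2) := by
    intro w hw hc
    rcases hy with hy | rfl
    · exact hw ⟨y, hy, closedBall_mono (by omega) hc⟩
    · refine hw ⟨xbar, hxbar.1, ?_⟩
      exact closedBall_mono (by omega)
        (mem_closedBall_trans (mem_closedBall_one hxbar.2.symm) hc)
  have hmain := hgood.abs_green_sub_le hd hreg hG (by omega) hbar hy (M := M) fun w hw =>
    ⟨hfar y w fun hc => hnotmem w hw (closedBall_mono (by omega) hc),
      fun z hz => hfar y z fun hc =>
        hnotmem w hw (mem_closedBall_trans (R := J + 1) (S := 1) hc (mem_closedBall_one hz))⟩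
  have hJs : (J : ℝ) + 3 = s := by rw [hJ]; push_cast; ring
  have hq7 : 0 < q ^ 7 := by positivity
  have h17 : L ^ 17 / N ≤ 1 / q ^ 7 := by
    rw [div_le_div_iff₀ hN hq7, one_mul]
    calc L ^ 17 * q ^ 7 ≤ L ^ 17 * q ^ 8 := by gcongr; norm_num
      _ = L ^ 21 := by rw [← hqL]; ring
      _ ≤ N := h21
  have hbd1 : 4 * (J + 2) / N ≤ 4 * (α / lam) / q ^ 7 := by
    calc 4 * (J + 2) / N ≤ 4 * (α * (L / lam)) / N := by
          gcongr
          linarith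
      _ = 4 * (α / lam) * (L / N) := by ring
      _ ≤ 4 * (α / lam) * (L ^ 17 / N) := by
          gcongr
          exact le_self_pow₀ hL1 (by norm_num)
      _ ≤ 4 * (α / lam) * (1 / q ^ 7) := by gcongr
      _ = _ := by ring
  -- The factor `J + 3` is bounded crudely by a multiple of `L`, and `(d-1)^(-(J+1))` by a multiple
  -- of `L^(-8)`; the root of the product is of order `q^(-7) = L^(-7/2)`.
  have hbd2 : √((J + 3) * ((d - 1 : ℝ)⁻¹) ^ (J + 1))
      ≤ √(α * ((d : ℝ) - 1) ^ 3 * lam ^ 7) / q ^ 7 := by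
    rw [← Real.sqrt_sq hq7.le, ← Real.sqrt_div (by positivity)]
    refine Real.sqrt_le_sqrt ?_
    have h1 : ((d - 1 : ℝ)⁻¹) ^ (J + 1) ≤ ((d : ℝ) - 1) ^ 3 * (lam / L) ^ 8 := by
      rw [inv_pow, inv_le_iff_one_le_mul₀ (by positivity)]
      have h2 : ((d : ℝ) - 1) ^ (s + 1) = ((d : ℝ) - 1) ^ 3 * ((d : ℝ) - 1) ^ (J + 1) := by
        rw [← pow_add]; congr 1; omega
      rw [h2] at hslow
      calc (1 : ℝ) = (lam / L) ^ 8 * (L / lam) ^ 8 := by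
            rw [← mul_pow, div_mul_div_cancel₀ (by linarith : L ≠ 0), div_self hlam.ne', one_pow]
        _ ≤ (lam / L) ^ 8 * (((d : ℝ) - 1) ^ 3 * ((d : ℝ) - 1) ^ (J + 1)) := by gcongr
        _ = _ := by ring
    calc (J + 3) * ((d - 1 : ℝ)⁻¹) ^ (J + 1)
        ≤ (α * (L / lam)) * (((d : ℝ) - 1) ^ 3 * (lam / L) ^ 8) := by
          rw [hJs]
          gcongr
      _ = α * ((d : ℝ) - 1) ^ 3 * lam ^ 7 / (q ^ 7) ^ 2 := by
          rw [show (q ^ 7) ^ 2 = L ^ 7 by rw [← hqL]; ring]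
          field_simp
  have hbd3 : d * (A.card * (d + 1 : ℝ) ^ s / N) ≤ d * b / lam ^ 16 / q ^ 7 := by
    -- For `d ≥ 3` one has `d + 1 ≤ (d-1)^2`, which turns the crude volume bound into a power of
    -- `L`.
    have h1 : (d + 1 : ℝ) ^ s ≤ (L / lam) ^ 16 := by
      calc (d + 1 : ℝ) ^ s ≤ (((d : ℝ) - 1) ^ 2) ^ s := by
            gcongr
            nlinarith
        _ = (((d : ℝ) - 1) ^ s) ^ 2 := by rw [← pow_mul, ← pow_mul, mul_comm]
        _ ≤ ((L / lam) ^ 8) ^ 2 := by gcongr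
        _ = _ := by ring
    calc d * (A.card * (d + 1 : ℝ) ^ s / N) ≤ d * (b * L * (L / lam) ^ 16 / N) := by gcongr
      _ = d * b / lam ^ 16 * (L ^ 17 / N) := by field_simp
      _ ≤ d * b / lam ^ 16 * (1 / q ^ 7) := by gcongr
      _ = _ := by ring
  refine hmain.trans ?_
  calc 2 * M + d * (A.card * (d + 1 : ℝ) ^ s / N)
      ≤ 2 * (4 * (α / lam) / q ^ 7 + 4 * β⁻¹ * (√(α * ((d : ℝ) - 1) ^ 3 * lam ^ 7) / q ^ 7))
        + d * b / lam ^ 16 / q ^ 7 := by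
        rw [hM]
        gcongr
    _ = _ := by ring

/-- A residual bound without decay, sufficient when the number of vertices stays below a fixed
threshold. -/
theorem IsGreenEigensystem.abs_green_sub_le_of_bounded (hd : 3 ≤ d) (hβ : 0 < β)
    (hG : IsGreenEigensystem G d β u μ) (x xbar y : V) {e : ℝ} (he0 : 0 ≤ e) (he : e ≤ 2) :
    |greenFunction G y x - (d - 1 : ℝ)⁻¹ * greenFunction G y xbar - e| ≤ 2 * β⁻¹ + 2 := by
  have hd' : (3 : ℝ) ≤ d := by exact_mod_cast hd
  have hd0 : (0 : ℝ) < (d : ℝ) - 1 := by linarith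
  have h1 := hG.abs_green_le hβ y x
  have h2 : |(d - 1 : ℝ)⁻¹ * greenFunction G y xbar| ≤ 1 * β⁻¹ := by
    rw [abs_mul, abs_of_pos (inv_pos.2 hd0)]
    gcongr
    · exact inv_le_one_of_one_le₀ (by linarith)
    · exact hG.abs_green_le hβ y xbar
  calc _ ≤ |greenFunction G y x| + |(d - 1 : ℝ)⁻¹ * greenFunction G y xbar| + |e| :=
        (abs_sub _ _).trans (add_le_add_left (abs_sub _ _) _)
    _ ≤ β⁻¹ + 1 * β⁻¹ + 2 := by
        gcongr
        rwa [abs_of_nonneg he0]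
    _ = _ := by ring

end Bounds

end ZeroAvgGFF

/-! ### Assembly of the estimates -/

theorem proposition3p9 (d : ℕ) (hd : 3 ≤ d) (α β : ℝ) (hα : 0 < α) (hβ : 0 < β)
    (b b' : ℝ) (hb : 0 < b) (hb' : 0 < b') :
    ∃ c : ℝ, 0 < c ∧
      ∀ (V : ℕ → Type*) [∀ n, Fintype (V n)] [∀ n, DecidableEq (V n)]
        (G : ∀ n, SimpleGraph (V n)) [∀ n, DecidableRel (G n).Adj],
        ZeroAvgGFF.StandingAssumptions d α β G →
        ∀ (n : ℕ) (A : Finset (V n)), A.Nonempty →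
          (A.card : ℝ) ≤ b * Real.log (Fintype.card (V n) : ℝ) →
          ∀ x xbar : V n,
            ZeroAvgGFF.IsGoodBoundaryVertex (G n)
              (ZeroAvgGFF.scale d (Fintype.card (V n))) (A : Set (V n)) x →
            ZeroAvgGFF.closedBall (G n) x 1 ∩ (A : Set (V n)) = {xbar} →
            ∀ᵐ ψ ∂(ZeroAvgGFF.fieldLaw (G n)),
              (∀ z ∈ A, |ψ z| ≤ b' * √(Real.log (Fintype.card (V n) : ℝ))) →
              |((ZeroAvgGFF.fieldLaw (G n))[fun φ : V n → ℝ => φ x |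
                    cylinderEvents (X := fun _ : V n => ℝ) (A : Set (V n))]) ψ
                  - 1 / ((d : ℝ) - 1) * ψ xbar|
                ≤ c / Real.log (Fintype.card (V n) : ℝ) ^ 2 ∧
              |(Var[fun φ : V n → ℝ => φ x ; ZeroAvgGFF.fieldLaw (G n) |
                    cylinderEvents (X := fun _ : V n => ℝ) (A : Set (V n))]) ψ
                  - (d : ℝ) / ((d : ℝ) - 1)|
                ≤ c / Real.log (Fintype.card (V n) : ℝ) ^ 3 := by
  have hd' : (3 : ℝ) ≤ d := by exact_mod_cast hd
  have hd0 : (0 : ℝ) < (d : ℝ) - 1 := by linarith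
  have hlam : 0 < Real.log ((d : ℝ) - 1) := Real.log_pos (by linarith)
  obtain ⟨N₀, hN₀⟩ := Filter.eventually_atTop.1 (ZeroAvgGFF.eventually_scale (b := b) hd hα)
  set K : ℝ := 2 * (4 * (α / Real.log ((d : ℝ) - 1))
    + 4 * β⁻¹ * √(α * ((d : ℝ) - 1) ^ 3 * Real.log ((d : ℝ) - 1) ^ 7))
    + d * b / Real.log ((d : ℝ) - 1) ^ 16 with hK
  have hK0 : 0 ≤ K := by positivity
  set E : ℝ := 2 * β⁻¹ + 2 with hE
  have hE0 : 0 ≤ E := by positivity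
  set m : ℝ := N₀ + 1 with hm
  have hm1 : 1 ≤ m := by
    have : (0 : ℝ) ≤ N₀ := Nat.cast_nonneg N₀
    linarith
  -- `c₁` and `c₂` bound the mean and variance errors for graphs with at least `N₀` vertices, `c₃`
  -- and `c₄` those for smaller graphs, where `m` dominates `N`, `L`, `q` and `|A|`.
  set c₁ : ℝ := 4 * b * b' * K with hc₁
  set c₂ : ℝ := 2 * K + 4 * b * K ^ 2 with hc₂
  set c₃ : ℝ := 2 * m * (m * E * (b' * m)) * m ^ 2 with hc₃
  set c₄ : ℝ := (2 * E + 2 * m * (m * E ^ 2)) * m ^ 3 with hc₄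
  have h₁ : 0 ≤ c₁ := by positivity
  have h₂ : 0 ≤ c₂ := by positivity
  have h₃ : 0 ≤ c₃ := by positivity
  have h₄ : 0 ≤ c₄ := by positivity
  refine ⟨c₁ + c₂ + c₃ + c₄ + 1, by positivity, ?_⟩
  intro V _ _ G _ hG n A _ hA x xbar hgood hbar
  have hreg := hG.regular n
  obtain ⟨u, μ, hspec⟩ := ZeroAvgGFF.exists_isGreenEigensystem (by omega) hreg (hG.connected n) hβ
    (hG.spectral_gap n)
  have hxA : x ∉ A := hgood.mem_boundary.1
  have hbarA : xbar ∈ A := (ZeroAvgGFF.adj_of_closedBall_inter_eq hgood.mem_boundary.1 hbar).1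
  have hxb : ∀ y ∈ A, y ≠ x := fun y hy he => hxA (he ▸ hy)
  have hL1 : 1 ≤ Real.log (Fintype.card (V n)) := ZeroAvgGFF.one_le_log_card hd hreg x
  have hN : (0 : ℝ) < Fintype.card (V n) := by exact_mod_cast Fintype.card_pos_iff.2 ⟨x⟩
  set N : ℝ := ((Fintype.card (V n) : ℕ) : ℝ) with hNdef
  set L := Real.log N with hL
  have hL0 : 0 < L := by linarith
  set q := √L with hq
  have hq1 : 1 ≤ q := Real.one_le_sqrt.2 hL1
  have hqL : q ^ 2 = L := Real.sq_sqrt hL0.le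
  by_cases hlarge : N₀ ≤ Fintype.card (V n)
  · obtain ⟨g1, g2, g3, g4, g5, g6, -⟩ := hN₀ _ hlarge
    have hr := fun y hy => hgood.abs_green_sub_le_of_large hd hreg hβ hspec hα hb
      (hG.locally_unicyclic n) g1 g2 g3 g4 g5 hA hbar (y := y) hy
    have hκ : (1 / 2 : ℝ) ≤ 1 - A.card / N := by
      have : (A.card : ℝ) / N ≤ 1 / 2 := by
        rw [div_le_iff₀ hN]
        linarith
      linarith
    -- With `ε` of order `q^(-7)`, `|A|` of order `q^2` and field bound `b' * q`, the mean error is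
    -- of order `q^(-4) = L^(-2)`.
    have hmain := hspec.ae_condExp_condVar_le hβ hd A (κ := 1 / 2) (by norm_num) hκ (x := x) hbarA
      (ε := K / q ^ 7) (by positivity)
      (fun y hy => by simpa [hxb y hy] using hr y (.inl hy))
      (by simpa using hr x (.inr rfl)) (B := b' * q) (by positivity)
    filter_upwards [hmain] with ψ hψ hψA
    obtain ⟨ha, hv⟩ := hψ hψA
    constructor
    · refine ha.trans ?_
      calc 2 / (1 / 2) * (A.card * (K / q ^ 7) * (b' * q))
          ≤ 2 / (1 / 2) * (b * L * (K / q ^ 7) * (b' * q)) := by gcongr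
        _ = c₁ / L ^ 2 := by
            rw [hc₁, ← hqL]
            field_simp
            ring
        _ ≤ _ := by
            gcongr
            linarith
    · refine hv.trans ?_
      have hq7 : K / q ^ 7 ≤ K / L ^ 3 := by
        rw [← hqL, ← pow_mul]
        gcongr
        norm_num
      have hq12 : L * (K / q ^ 7) ^ 2 ≤ K ^ 2 / L ^ 3 := by
        calc L * (K / q ^ 7) ^ 2 = K ^ 2 / L ^ 6 := by
              rw [← hqL]
              field_simp
          _ ≤ K ^ 2 / L ^ 3 := by
              gcongr
              norm_num
      calc 2 * (K / q ^ 7) + 2 / (1 / 2) * (A.card * (K / q ^ 7) ^ 2)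
          ≤ 2 * (K / q ^ 7) + 2 / (1 / 2) * (b * L * (K / q ^ 7) ^ 2) := by gcongr
        _ = 2 * (K / q ^ 7) + 4 * b * (L * (K / q ^ 7) ^ 2) := by ring
        _ ≤ 2 * (K / L ^ 3) + 4 * b * (K ^ 2 / L ^ 3) := by gcongr
        _ = c₂ / L ^ 3 := by rw [hc₂]; ring
        _ ≤ _ := by
            gcongr
            linarith
  · have hNm : N ≤ m := by
      have : (Fintype.card (V n) : ℝ) ≤ N₀ := by exact_mod_cast (not_le.1 hlarge).le
      linarith
    have hLm : L ≤ m := (Real.log_le_self hN.le).trans hNm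
    have hqm : q ≤ m := by nlinarith
    -- Since `x ∉ A`, the set `A` is proper, and the coercivity constant stays at least `1/N ≥ 1/m`.
    have hAN : (A.card : ℝ) + 1 ≤ N := by
      have h1 : A.card < Fintype.card (V n) :=
        Finset.card_lt_univ_of_notMem hxA
      rw [hNdef]
      exact_mod_cast h1
    have hAm : (A.card : ℝ) ≤ m := by linarith
    have hκ : 1 / m ≤ 1 - A.card / N := by
      calc 1 / m ≤ 1 / N := by gcongr
        _ ≤ 1 - A.card / N := by
            rw [le_sub_iff_add_le, ← add_div, div_le_one hN]
            linarith
    have hdd : (d : ℝ) / (d - 1) ≤ 2 := by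
      rw [div_le_iff₀ hd0]
      linarith
    have hmain := hspec.ae_condExp_condVar_le hβ hd A (κ := 1 / m) (by positivity) hκ (x := x)
      hbarA (ε := E) hE0
      (fun y _ => by simpa using
        hspec.abs_green_sub_le_of_bounded hd hβ x xbar y (e := 0) le_rfl (by norm_num))
      (hspec.abs_green_sub_le_of_bounded hd hβ x xbar x (by positivity) hdd)
      (B := b' * q) (by positivity)
    filter_upwards [hmain] with ψ hψ hψA
    obtain ⟨ha, hv⟩ := hψ hψA
    constructor
    · refine ha.trans ?_
      rw [le_div_iff₀ (by positivity)]
      calc 2 / (1 / m) * (A.card * E * (b' * q)) * L ^ 2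
          ≤ 2 / (1 / m) * (m * E * (b' * m)) * m ^ 2 := by gcongr
        _ = c₃ := by rw [hc₃, div_div_eq_mul_div, div_one]
        _ ≤ _ := by linarith
    · refine hv.trans ?_
      rw [le_div_iff₀ (by positivity)]
      calc (2 * E + 2 / (1 / m) * (A.card * E ^ 2)) * L ^ 3
          ≤ (2 * E + 2 / (1 / m) * (m * E ^ 2)) * m ^ 3 := by gcongr
        _ = c₄ := by rw [hc₄, div_div_eq_mul_div, div_one]
        _ ≤ _ := by linarith
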